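/- Let $R>0$, let $B_R\subset\mathbb R^3$ be the open ball of radius $R$ around the origin, and let $\mu\in C^\infty(\mathbb R_{\ge 0})$ be a cut-off function with $0\le\mu\le 1$, $\mu=1$ on $[0,2R]$, $\mu=0$ on $[4R,\infty)$, $|\mu'|\le C_\mu/R$ and $|\mu''|\le C_\mu/R^2$. Put $M(x):=\mu(\|x\|)$ and, for $\zeta\in\mathbb C$, $$G(\zeta,x):=\frac{e^{-\zeta\|x\|}}{4\pi\|x\|},\qquad x\in\mathbb R^3\setminus\{0\}.$$ For $\phi\in L^2(\mathbb R^3)$ supported in $B_R$ and $\operatorname{Re}\zeta\ge 0$ let $$z:=G(\overline\zeta)*\phi,\qquad z_\mu:=(G(\overline\zeta)M)*\phi .$$ Here $\|\cdot\|$ is the norm of $L^2(\mathbb R^3)$, $\|\nabla^p w\|:=\big(\sum_{|\alpha|=p}\tfrac{p!}{\alpha!}\|\partial^\alpha w\|^2\big)^{1/2}$ with weak derivatives, $\|w\|_{\rho}:=(\|\nabla w\|^2+\rho^2\|w\|^2)^{1/2}$, and $\hat w(\xi)=(2\pi)^{-3/2}\int_{\mathbb R^3} e^{-i\langle\xi,x\rangle}w(x)\,dx$,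 extended to $L^2(\mathbb R^3)$. All bounds include the assertion that the derivatives involved exist and lie in $L^2(\mathbb R^3)$. 1. Both convolution integrals converge absolutely at every point, and $z_\mu=z$ on $B_R$. 2. There is a constant $C>0$ depending only on $R$ and $\mu$ such that, for all $\phi\in L^2(\mathbb R^3)$ supported in $B_R$ and all $\zeta\in\mathbb C$ with $\operatorname{Re}\zeta\ge 0$, $$\|z_\mu\|_{|\zeta|}\le\frac{C}{1+\operatorname{Re}\zeta}\,\|\phi\| .$$ 3. For every $\lambda_0>1$ there is a constant $C'>0$ depending only on $\lambda_0$, $R$ and $\mu$ such that, for all $\phi\in L^2(\mathbb R^3)$ supported in $B_R$, all $\zeta$ with $\operatorname{Re}\zeta\ge0$ and $\operatorname{Im}\zeta\neq0$, and all $\lambda\ge\lambda_0$, there is a splitting $z_\mu=z_{H^2}+z_{\mathcal A}$ (depending on $\lambda$ and $\zeta$) with $z_{H^2},z_{\mathcal A}\in L^2(\mathbb R^3)$, $\widehat{z_{H^2}}(\xi)=0$ for almost every $\|\xi\|<\lambda|\operatorname{Im}\zeta|$, $\widehat{z_{\mathcal A}}(\xi)=0$ for almost every $\|\xi\|\ge\lambda|\operatorname{Im}\zeta|$,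 and $$\|\nabla^p z_{H^2}\|\le C'\,\frac{\lambda}{\lambda-1}\Big(\frac{|\zeta|}{\operatorname{Im}\zeta}\Big)^2(\lambda|\operatorname{Im}\zeta|)^{p-2}\,\|\phi\|\qquad\text{for } p\in\{0,1,2\},$$ $$\|\nabla^p z_{\mathcal A}\|\le C'\,\frac{1+|\zeta|}{1+\operatorname{Re}\zeta}\,(\sqrt3\,\lambda|\operatorname{Im}\zeta|)^{p-2}\,\|\phi\|\qquad\text{for all integers } p\ge 2,$$ $$\|\nabla^p z_{\mathcal A}\|\le C'\,\lambda^{2-p}\,\frac{1+|\zeta|}{1+\operatorname{Re}\zeta}\,(\sqrt3\,\lambda|\operatorname{Im}\zeta|)^{p-2}\,\|\phi\|\qquad\text{for } p\in\{0,1\}.$$ -/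

import Mathlib

open MeasureTheory FourierTransform LineDeriv SchwartzMap
open scoped ENNReal ContDiff

noncomputable section

namespace HelmholtzSplitting

/-- Three-dimensional Euclidean space. -/
abbrev E3 : Type := EuclideanSpace ℝ (Fin 3)

/-- The space `L²(ℝ³)` of complex-valued functions. -/
abbrev L2 : Type := Lp ℂ 2 (volume : Measure E3)

/-- A cut-off function `μ ∈ C^∞(ℝ_{≥0})` with `supp μ ⊆ [0, 4R]`, `μ = 1` on `[0, 2R]`,
`0 ≤ μ ≤ 1`, `|μ'| ≤ Cμ / R` and `|μ''| ≤ Cμ / R²`.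
Only the values of `μ` on `[0, ∞)` matter; derivatives are taken within `[0, ∞)`. -/
structure IsCutoff (R Cμ : ℝ) (μ : ℝ → ℝ) : Prop where
  contDiffOn : ContDiffOn ℝ ∞ μ (Set.Ici 0)
  nonneg : ∀ r, 0 ≤ r → 0 ≤ μ r
  le_one : ∀ r, 0 ≤ r → μ r ≤ 1
  eq_one : ∀ r, 0 ≤ r → r ≤ 2 * R → μ r = 1
  eq_zero : ∀ r, 4 * R ≤ r → μ r = 0
  deriv_le : ∀ r, 0 ≤ r → |derivWithin μ (Set.Ici 0) r| ≤ Cμ / R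
  deriv_two_le : ∀ r, 0 ≤ r → |iteratedDerivWithin 2 μ (Set.Ici 0) r| ≤ Cμ / R ^ 2

/-- The fundamental solution `G(ζ, x) = e^{-ζ‖x‖} / (4π‖x‖)` of `-Δ + ζ²` in `ℝ³`
(its value at the single point `0` is irrelevant). -/
def kernel (ζ : ℂ) (x : E3) : ℂ :=
  Complex.exp (-ζ * (‖x‖ : ℂ)) / (4 * (Real.pi : ℂ) * (‖x‖ : ℂ))

/-- The truncated kernel `G(ζ, ·) M`, where `M(x) = μ(‖x‖)`. -/
def cutKernel (μ : ℝ → ℝ) (ζ : ℂ) (x : E3) : ℂ :=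
  kernel ζ x * (μ ‖x‖ : ℂ)

/-- The convolution `(K * φ)(x) = ∫ φ(y) K(x - y) dy` over `ℝ³`. -/
def conv (K : E3 → ℂ) (φ : L2) : E3 → ℂ :=
  convolution (φ : E3 → ℂ) K (ContinuousLinearMap.mul ℂ ℂ) volume

/-- The integral that defines `(K * φ)(x)` converges absolutely for every `x`. -/
def ConvConverges (K : E3 → ℂ) (φ : L2) : Prop :=
  ConvolutionExists (φ : E3 → ℂ) K (ContinuousLinearMap.mul ℂ ℂ) volume

/-- `g i` is the `p`-th order partial derivative `∂_{i 0} ⋯ ∂_{i (p-1)} f` in the sense of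
(tempered) distributions, for each of the `3 ^ p` index tuples `i`. -/
def IsWeakGradient (p : ℕ) (f : L2) (g : (Fin p → Fin 3) → L2) : Prop :=
  ∀ i : Fin p → Fin 3,
    ∂^{fun j => (EuclideanSpace.single (i j) (1 : ℝ) : E3)} (f : 𝓢'(E3, ℂ)) = (g i : 𝓢'(E3, ℂ))

/-- `‖∇^p f‖ = (∑_{|α| = p} (p choose α) ‖∂^α f‖²)^{1/2}`, written as a sum over all index tuples
(each multi-index `α` arises from `p! / α!` tuples). The weak derivatives are unique, so the
infimum is over at most one `g`; it is `∞` if some derivative of order `p` is not in `L²`. -/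
def gradNorm (p : ℕ) (f : L2) : ℝ≥0∞ :=
  ⨅ (g : (Fin p → Fin 3) → L2) (_ : IsWeakGradient p f g),
    ENNReal.ofReal (Real.sqrt (∑ i, ‖g i‖ ^ 2))

/-- The weighted norm `‖f‖_ρ = (‖∇f‖² + ρ² ‖f‖²)^{1/2}`. -/
def weightedNorm (ρ : ℝ) (f : L2) : ℝ≥0∞ :=
  (gradNorm 1 f ^ 2 + ENNReal.ofReal (ρ ^ 2 * ‖f‖ ^ 2)) ^ (1 / 2 : ℝ)

/-- The Fourier transform of `f` vanishes at all frequencies `|ξ| ≥ δ`. Frequencies are angular,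
i.e. those of `e^{i⟨ξ, x⟩}`, whereas `𝓕` is normalised with `e^{-2πi⟨ξ, x⟩}`. -/
def IsLowFrequency (δ : ℝ) (f : L2) : Prop :=
  ∀ᵐ ξ : E3, δ ≤ 2 * Real.pi * ‖ξ‖ → (𝓕 f : L2) ξ = 0

/-- The Fourier transform of `f` vanishes at all (angular) frequencies `|ξ| < δ`. -/
def IsHighFrequency (δ : ℝ) (f : L2) : Prop :=
  ∀ᵐ ξ : E3, 2 * Real.pi * ‖ξ‖ < δ → (𝓕 f : L2) ξ = 0

/-- `φ` is supported in the ball `B_R(0)`. -/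
def SupportedInBall (R : ℝ) (φ : L2) : Prop :=
  ∀ᵐ x : E3, x ∉ Metric.ball (0 : E3) R → φ x = 0

end HelmholtzSplitting

end

noncomputable section

namespace HelmholtzSplitting

/-! Convolution with the truncated kernel is a Fourier multiplier, so every bound reduces to a
scalar estimate of its symbol. With `s = conj ζ` and angular frequency `k`, the symbol is the sine
transform `m(k) = ∫₀^∞ (sin(kr)/k) e^{-sr} μ(r) dr` (`fourier_radialKernel`): integrating a radial
function over planes orthogonal to `ξ` leaves a one-dimensional cosine transform.

Three bounds on `m` carry the proof. Both `k |m|` and `|s| |m|` are `O(1/(1 + Re s))`, the second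
after one integration by parts; by Plancherel they give the stability estimate. Two integrations by
parts give `|(k² + s²) m| = O(1)`, as the kernel is a fundamental solution up to cut-off terms.

The splitting is a sharp frequency cut at `k = λ|Im ζ|`. Above it `|k² + s²| ≥ (λ-1)/λ · k²`, so `k²
|m|` is bounded. For all `k`, `k² m = (k² + s²) m - s · (s m)` gives `k² |m| = O((1 + |s|)/(1 + Re
s))`, which covers the low part for `p ≥ 2`; the cases `p ≤ 1` use the first two bounds. -/

/-! ### Weak derivatives as Fourier multipliers. -/

theorem hasTemperateGrowth_prod {p : ℕ} {g : Fin p → E3 → ℂ}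
    (h : ∀ j, (g j).HasTemperateGrowth) :
    Function.HasTemperateGrowth fun ξ : E3 => ∏ j, g j ξ := by
  induction p with
  | zero => simp
  | succ p ih =>
    simp_rw [Fin.prod_univ_succ]
    exact (h 0).mul (ih fun j => h j.succ)

theorem fourier_iteratedLineDerivOp (p : ℕ) (m : Fin p → E3) (F : 𝓢'(E3, ℂ)) :
    𝓕 (∂^{m} F) = TemperedDistribution.smulLeftCLM ℂ
      (fun ξ : E3 => ∏ j, (2 * Real.pi * Complex.I) * ((inner ℝ ξ (m j) : ℝ) : ℂ)) (𝓕 F) := by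
  induction p with
  | zero => simp
  | succ p ih =>
    have h1 : Function.HasTemperateGrowth
        (fun ξ : E3 => ((inner ℝ ξ (m 0) : ℝ) : ℂ)) := by fun_prop
    have h2 : Function.HasTemperateGrowth (fun ξ : E3 => ∏ j : Fin p,
        (2 * Real.pi * Complex.I) * ((inner ℝ ξ (Fin.tail m j) : ℝ) : ℂ)) :=
      hasTemperateGrowth_prod fun j => by fun_prop
    rw [iteratedLineDerivOp_succ_left, TemperedDistribution.fourier_lineDerivOp_eq, ih,
      TemperedDistribution.smulLeftCLM_smulLeftCLM_apply h2 h1, ← smul_apply,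
      ← TemperedDistribution.smulLeftCLM_smul (h2.mul h1)]
    congr 2
    ext ξ
    simp only [Pi.smul_apply, Pi.mul_apply, smul_eq_mul, Fin.prod_univ_succ, Fin.tail]
    ring

/-- The symbol of `∂_{i 0} ⋯ ∂_{i (p-1)}`. -/
def derivSymbol {p : ℕ} (i : Fin p → Fin 3) (ξ : E3) : ℂ :=
  ∏ j, (2 * Real.pi * Complex.I) * ((ξ (i j) : ℝ) : ℂ)

theorem isWeakGradient_of_fourier {p : ℕ} {f : L2} {g : (Fin p → Fin 3) → L2}
    (h : ∀ i, (𝓕 (g i) : L2) =ᵐ[volume] fun ξ => derivSymbol i ξ * (𝓕 f : L2) ξ) :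
    IsWeakGradient p f g := by
  intro i
  apply (fourierEquiv ℂ 𝓢'(E3, ℂ)).injective
  simp only [fourierEquiv_apply]
  rw [fourier_iteratedLineDerivOp, Lp.fourier_toTemperedDistribution_eq,
    Lp.fourier_toTemperedDistribution_eq]
  ext u
  have h2 : Function.HasTemperateGrowth (fun ξ : E3 => ∏ j : Fin p,
      (2 * Real.pi * Complex.I) *
        ((inner ℝ ξ (EuclideanSpace.single (i j) (1 : ℝ) : E3) : ℝ) : ℂ)) :=
    hasTemperateGrowth_prod fun j => by fun_prop
  rw [TemperedDistribution.smulLeftCLM_apply_apply, Lp.toTemperedDistribution_apply,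
    Lp.toTemperedDistribution_apply]
  apply integral_congr_ae
  filter_upwards [h i] with ξ hξ
  rw [hξ, SchwartzMap.smulLeftCLM_apply_apply h2]
  simp only [derivSymbol, EuclideanSpace.inner_single_right, smul_eq_mul]
  simp
  ring

theorem measurable_derivSymbol {p : ℕ} (i : Fin p → Fin 3) : Measurable (derivSymbol i) := by
  unfold derivSymbol
  fun_prop

/-- Expansion of `(∑ₐ |ξₐ|²)^p` over index tuples. Because it is an identity, the gradient norm
corresponds exactly to the multiplier `|ξ|^p`, with no dimensional constant. -/
theorem sum_norm_derivSymbol_sq (p : ℕ) (ξ : E3) :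
    ∑ i : Fin p → Fin 3, ‖derivSymbol i ξ‖ ^ 2 = ((2 * Real.pi * ‖ξ‖) ^ p) ^ 2 := by
  have h : ∀ i : Fin p → Fin 3,
      ‖derivSymbol i ξ‖ ^ 2 = ∏ j, ((2 * Real.pi) ^ 2 * ‖ξ (i j)‖ ^ 2) := by
    intro i
    simp [derivSymbol, ← Finset.prod_pow, mul_pow]
  simp_rw [h]
  rw [← Fintype.sum_pow (fun a : Fin 3 => (2 * Real.pi) ^ 2 * ‖ξ a‖ ^ 2) p, ← Finset.mul_sum,
    ← EuclideanSpace.norm_sq_eq, ← mul_pow, ← pow_mul, ← pow_mul, mul_comm p]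

theorem norm_derivSymbol_le {p : ℕ} (i : Fin p → Fin 3) (ξ : E3) :
    ‖derivSymbol i ξ‖ ≤ (2 * Real.pi * ‖ξ‖) ^ p := by
  apply le_of_sq_le_sq _ (by positivity)
  rw [← sum_norm_derivSymbol_sq]
  exact Finset.single_le_sum (f := fun i : Fin p → Fin 3 => ‖derivSymbol i ξ‖ ^ 2)
    (fun _ _ => sq_nonneg _) (Finset.mem_univ i)

theorem norm_sq_eq_integral (f : L2) : ‖f‖ ^ 2 = ∫ x, ‖f x‖ ^ 2 := by
  have h := L2.inner_def (𝕜 := ℂ) f f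
  rw [inner_self_eq_norm_sq_to_K] at h
  have h2 : (∫ x, inner ℂ (f x) (f x)) = ((∫ x, ‖f x‖ ^ 2 : ℝ) : ℂ) := by
    rw [← integral_complex_ofReal]
    congr 1
    ext x
    rw [inner_self_eq_norm_sq_to_K]
    norm_cast
  rw [h2] at h
  exact Complex.ofReal_injective (by simpa using h)

theorem integrable_norm_sq (f : L2) : Integrable fun x => ‖f x‖ ^ 2 :=
  (Lp.memLp f).integrable_norm_pow (by norm_num)

/-- Plancherel: the derivatives are constructed on the Fourier side, where the pointwise bound both
puts them in `L²` and controls their sum of squares. In use, `h` is the transform of `φ`. -/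
theorem gradNorm_le_of_fourier {p : ℕ} {f h : L2} {B : ℝ} (hB : 0 ≤ B)
    (hb : ∀ᵐ ξ, (2 * Real.pi * ‖ξ‖) ^ p * ‖(𝓕 f : L2) ξ‖ ≤ B * ‖h ξ‖) :
    gradNorm p f ≤ ENNReal.ofReal (B * ‖h‖) := by
  have hmem : ∀ i : Fin p → Fin 3,
      MemLp (fun ξ => derivSymbol i ξ * (𝓕 f : L2) ξ) 2 volume := by
    intro i
    refine MemLp.of_le_mul (c := B) (Lp.memLp h)
      ((measurable_derivSymbol i).aestronglyMeasurable.mul (Lp.aestronglyMeasurable _)) ?_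
    filter_upwards [hb] with ξ hξ
    rw [norm_mul]
    exact (mul_le_mul_of_nonneg_right (norm_derivSymbol_le i ξ) (norm_nonneg _)).trans hξ
  let G : (Fin p → Fin 3) → L2 := fun i => (hmem i).toLp
  have hG : ∀ i, G i =ᵐ[volume] fun ξ => derivSymbol i ξ * (𝓕 f : L2) ξ :=
    fun i => (hmem i).coeFn_toLp
  have hweak : IsWeakGradient p f fun i => 𝓕⁻ (G i) := by
    apply isWeakGradient_of_fourier
    intro i
    rw [fourier_fourierInv_eq]
    exact hG i
  refine (iInf₂_le _ hweak).trans (ENNReal.ofReal_le_ofReal ?_)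
  apply Real.sqrt_le_iff.2 ⟨by positivity, ?_⟩
  have hn : ∀ i, ‖(𝓕⁻ (G i) : L2)‖ = ‖G i‖ := by
    intro i
    rw [← Lp.norm_fourier_eq, fourier_fourierInv_eq]
  simp_rw [hn, norm_sq_eq_integral]
  rw [← integral_finsetSum _ fun i _ => integrable_norm_sq (G i), mul_pow, norm_sq_eq_integral,
    ← integral_const_mul]
  apply integral_mono_ae (integrable_finsetSum _ fun i _ => integrable_norm_sq (G i))
    ((integrable_norm_sq h).const_mul _)
  filter_upwards [hb, ae_all_iff.2 hG] with ξ hξ hGξ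
  simp_rw [hGξ, norm_mul, mul_pow]
  rw [← Finset.sum_mul, sum_norm_derivSymbol_sq, ← mul_pow, ← mul_pow]
  exact pow_le_pow_left₀ (by positivity) hξ 2

/-! ### Agreement of the `L²` and the integral Fourier transform. -/

theorem integral_smul_fourier_toLp {f : E3 → ℂ} (h1 : Integrable f) (h2 : MemLp f 2 volume)
    (u : 𝓢(E3, ℂ)) : ∫ x, u x • (𝓕 h2.toLp : L2) x = ∫ x, u x • 𝓕 f x := by
  have e1 : ∫ x, u x • (𝓕 h2.toLp : L2) x = ∫ x, (𝓕 u) x • f x := by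
    rw [← Lp.toTemperedDistribution_apply, ← Lp.fourier_toTemperedDistribution_eq,
      TemperedDistribution.fourier_apply, Lp.toTemperedDistribution_apply]
    apply integral_congr_ae
    filter_upwards [h2.coeFn_toLp] with x hx
    rw [hx]
  rw [e1, SchwartzMap.fourier_coe]
  have h := VectorFourier.integral_fourierIntegral_smul_eq_flip (L := innerₗ E3)
    Real.continuous_fourierChar continuous_inner (u.integrable (μ := volume)) h1
  rwa [flip_innerₗ] at h

theorem continuous_fourier_of_integrable {f : E3 → ℂ} (h1 : Integrable f) : Continuous (𝓕 f) :=
  VectorFourier.fourierIntegral_continuous Real.continuous_fourierChar continuous_inner h1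

/-- On `L¹ ∩ L²`, the `L²` Fourier transform is given by the Fourier integral. -/
theorem fourier_toLp_ae_eq {f : E3 → ℂ} (h1 : Integrable f) (h2 : MemLp f 2 volume) :
    (𝓕 h2.toLp : L2) =ᵐ[volume] 𝓕 f := by
  have hcont := continuous_fourier_of_integrable h1
  generalize hF : (𝓕 h2.toLp : L2) = F
  have hF2 : MemLp F 2 volume := Lp.memLp F
  have hloc : LocallyIntegrable (fun ξ => F ξ - 𝓕 f ξ) volume :=
    (hF2.locallyIntegrable (by norm_num)).sub hcont.locallyIntegrable
  -- Fundamental lemma of the calculus of variations: it suffices to test against smooth compactly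
  -- supported functions, which are Schwartz.
  have key := ae_eq_zero_of_integral_contDiff_smul_eq_zero hloc ?_
  · filter_upwards [key] with ξ hξ
    exact sub_eq_zero.1 hξ
  intro g g_smooth g_cpt
  have hg₁ : HasCompactSupport (Complex.ofRealCLM ∘ g) := g_cpt.comp_left rfl
  have hg₂ : ContDiff ℝ ∞ (Complex.ofRealCLM ∘ g) := by fun_prop
  obtain ⟨u, hu⟩ : ∃ u : 𝓢(E3, ℂ), ∀ x, u x = (g x : ℂ) :=
    ⟨hg₁.toSchwartzMap hg₂, fun x => rfl⟩
  have hi1 : Integrable fun x => u x • F x := (u.memLp 2 volume).integrable_mul hF2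
  have hi2 : Integrable fun x => u x • 𝓕 f x := by
    refine (u.continuous.smul hcont).integrable_of_hasCompactSupport
      (HasCompactSupport.smul_right ?_)
    rwa [show (u : E3 → ℂ) = Complex.ofRealCLM ∘ g from funext hu]
  have e := integral_smul_fourier_toLp h1 h2 u
  rw [hF] at e
  calc ∫ x, g x • (F x - 𝓕 f x)
      = ∫ x, (u x • F x - u x • 𝓕 f x) := by
        congr 1
        ext x
        rw [← smul_sub, hu, Complex.coe_smul]
    _ = 0 := by rw [integral_sub hi1 hi2, e, sub_self]

/-! ### Fourier transform of radial kernels. -/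

/-- The radial function `x ↦ q(‖x‖) / (4π‖x‖)`. -/
def radialKernel (q : ℝ → ℂ) (x : E3) : ℂ := q ‖x‖ / (4 * (Real.pi : ℂ) * (‖x‖ : ℂ))

theorem integrableOn_Ioi_of_eq_zero {E : Type*} [NormedAddCommGroup E] {g : ℝ → E} {L : ℝ} (hg : ContinuousOn g (Set.Ici 0))
    (h0 : ∀ r, L ≤ r → g r = 0) : IntegrableOn g (Set.Ioi 0) := by
  have h1 : IntegrableOn g (Set.Icc 0 L) :=
    (hg.mono Set.Icc_subset_Ici_self).integrableOn_compact isCompact_Icc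
  refine h1.of_forall_sdiff_eq_zero measurableSet_Ioi fun r hr => h0 r ?_
  by_contra! h
  exact hr.2 ⟨hr.1.le, h.le⟩

/-- The fundamental theorem of calculus on `[0, ∞)` for functions of bounded support. -/
theorem integral_Ioi_deriv_of_eq_zero {F F' : ℝ → ℂ} {L : ℝ} (hF : ContinuousOn F (Set.Ici 0))
    (hF' : ContinuousOn F' (Set.Ici 0)) (hd : ∀ r, 0 < r → HasDerivAt F (F' r) r)
    (h0 : ∀ r, L ≤ r → F r = 0) (h0' : ∀ r, L ≤ r → F' r = 0) :
    ∫ r in Set.Ioi 0, F' r = -F 0 := by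
  have h := integral_Ioi_of_hasDerivAt_of_tendsto (m := 0) (hF 0 Set.self_mem_Ici)
    (fun r hr => hd r hr) (integrableOn_Ioi_of_eq_zero hF' h0') ?_
  · rw [h, zero_sub]
  · refine tendsto_const_nhds.congr' ?_
    filter_upwards [Filter.eventually_ge_atTop L] with r hr
    exact (h0 r hr).symm

theorem measurable_radialKernel {q : ℝ → ℂ} (hq : Continuous q) : Measurable (radialKernel q) := by
  unfold radialKernel
  have := hq.measurable
  fun_prop

theorem integrable_radialKernel {q : ℝ → ℂ} {L : ℝ} (hq : Continuous q)
    (h0 : ∀ r, L ≤ r → q r = 0) : Integrable (radialKernel q) := by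
  have h := (integrable_fun_norm_addHaar (volume : Measure E3)
    (f := fun r => q r / (4 * (Real.pi : ℂ) * (r : ℂ)))).2
  refine h ((integrableOn_congr_fun (f := fun r : ℝ => (r : ℂ) * q r / (4 * (Real.pi : ℂ))) ?_
    measurableSet_Ioi).1 ?_)
  · intro r (hr : 0 < r)
    have hr' : (r : ℂ) ≠ 0 := by exact_mod_cast hr.ne'
    have hpi : (Real.pi : ℂ) ≠ 0 := by exact_mod_cast Real.pi_ne_zero
    simp only [finrank_euclideanSpace, Fintype.card_fin, Complex.real_smul]
    push_cast
    field_simp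
  · refine integrableOn_Ioi_of_eq_zero (L := L) (by fun_prop) fun r hr => ?_
    simp [h0 r hr]

theorem memLp_radialKernel {q : ℝ → ℂ} {L : ℝ} (hq : Continuous q)
    (h0 : ∀ r, L ≤ r → q r = 0) : MemLp (radialKernel q) 2 volume := by
  rw [memLp_two_iff_integrable_sq_norm (measurable_radialKernel hq).aestronglyMeasurable]
  have h := (integrable_fun_norm_addHaar (volume : Measure E3)
    (f := fun r => ‖q r / (4 * (Real.pi : ℂ) * (r : ℂ))‖ ^ 2)).2
  refine h ((integrableOn_congr_fun (f := fun r : ℝ => ‖q r‖ ^ 2 / (4 * Real.pi) ^ 2) ?_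
    measurableSet_Ioi).1 ?_)
  · intro r (hr : 0 < r)
    have hpi := Real.pi_pos
    simp only [finrank_euclideanSpace, Fintype.card_fin, norm_div, norm_mul, Complex.norm_real,
      Real.norm_of_nonneg hr.le, Real.norm_of_nonneg hpi.le, Complex.norm_ofNat, smul_eq_mul]
    field_simp
  · refine integrableOn_Ioi_of_eq_zero (L := L) (by fun_prop) fun r hr => ?_
    simp [h0 r hr]

theorem hasDerivAt_tailIntegral {q : ℝ → ℂ} (L : ℝ) (hq : Continuous q) (t : ℝ) :
    HasDerivAt (fun t => ∫ r in t..L, q r) (-q t) t :=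
  intervalIntegral.integral_hasDerivAt_left (hq.intervalIntegrable _ _)
    (hq.stronglyMeasurableAtFilter _ _) hq.continuousAt

theorem tailIntegral_eq_zero {q : ℝ → ℂ} {L t : ℝ} (h0 : ∀ r, L ≤ r → q r = 0) (ht : L ≤ t) :
    ∫ r in t..L, q r = 0 := by
  rw [intervalIntegral.integral_congr (g := fun _ => (0 : ℂ)), intervalIntegral.integral_zero]
  intro r hr
  rw [Set.uIcc_of_ge ht] at hr
  exact h0 r hr.1

/-- The plane integral of a shifted radial function, in polar coordinates. -/
theorem integral_plane {q : ℝ → ℂ} {L z : ℝ} (hq : Continuous q)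
    (h0 : ∀ r, L ≤ r → q r = 0) (hz : z ≠ 0) :
    ∫ y : EuclideanSpace ℝ (Fin 2), q (Real.sqrt (z ^ 2 + ‖y‖ ^ 2)) /
      (4 * (Real.pi : ℂ) * (Real.sqrt (z ^ 2 + ‖y‖ ^ 2) : ℂ)) =
    (1 / 2) * ∫ r in |z|..L, q r := by
  have hpi : (Real.pi : ℂ) ≠ 0 := by exact_mod_cast Real.pi_ne_zero
  have hpos : ∀ r : ℝ, 0 < z ^ 2 + r ^ 2 := fun r => by positivity
  have hrad : Continuous fun r : ℝ => Real.sqrt (z ^ 2 + r ^ 2) := by fun_prop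
  have hne : ∀ r : ℝ, (Real.sqrt (z ^ 2 + r ^ 2) : ℂ) ≠ 0 := fun r => by
    exact_mod_cast (Real.sqrt_pos.2 (hpos r)).ne'
  have hbig : ∀ r : ℝ, |L| ≤ r → L ≤ Real.sqrt (z ^ 2 + r ^ 2) := fun r hr =>
    (le_abs_self L).trans (hr.trans (Real.le_sqrt_of_sq_le (by nlinarith [sq_nonneg z])))
  have hprim := hasDerivAt_tailIntegral L hq
  have hzero : ∀ t, L ≤ t → ∫ r in t..L, q r = 0 := fun t => tailIntegral_eq_zero h0
  rw [integral_fun_norm_addHaar (volume : Measure (EuclideanSpace ℝ (Fin 2)))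
    (fun r => q (Real.sqrt (z ^ 2 + r ^ 2)) /
      (4 * (Real.pi : ℂ) * (Real.sqrt (z ^ 2 + r ^ 2) : ℂ)))]
  have hball : (volume : Measure (EuclideanSpace ℝ (Fin 2))).real (Metric.ball 0 1) = Real.pi := by
    simp [Measure.real, EuclideanSpace.volume_ball_fin_two, Real.pi_pos.le]
  -- With `ρ = √(z² + r²)` one has `r dr = ρ dρ`, which cancels the weight `1/ρ`. The polar factor
  -- `2π` against `4π` leaves `1/2`.
  have key := integral_Ioi_deriv_of_eq_zero (L := |L|)
    (F := fun r : ℝ => -(∫ x in Real.sqrt (z ^ 2 + r ^ 2)..L, q x) / (4 * (Real.pi : ℂ)))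
    (F' := fun r : ℝ => q (Real.sqrt (z ^ 2 + r ^ 2)) * r / Real.sqrt (z ^ 2 + r ^ 2) /
      (4 * (Real.pi : ℂ))) ?_ ?_ ?_ ?_ ?_
  · have e : ∀ r : ℝ, (r ^ (2 - 1)) • (q (Real.sqrt (z ^ 2 + r ^ 2)) /
      (4 * (Real.pi : ℂ) * (Real.sqrt (z ^ 2 + r ^ 2) : ℂ))) =
      q (Real.sqrt (z ^ 2 + r ^ 2)) * r / Real.sqrt (z ^ 2 + r ^ 2) / (4 * (Real.pi : ℂ)) := by
      intro r
      have := hne r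
      simp only [Complex.real_smul]
      push_cast
      field_simp
    simp only [finrank_euclideanSpace, Fintype.card_fin]
    simp_rw [e]
    rw [key, hball]
    simp only [Complex.real_smul, nsmul_eq_mul, ne_eq, OfNat.ofNat_ne_zero, not_false_eq_true,
      zero_pow, add_zero, Real.sqrt_sq_eq_abs]
    push_cast
    field_simp
    ring
  · have hc : Continuous fun t => ∫ r in t..L, q r :=
      continuous_iff_continuousAt.2 fun t => (hprim t).continuousAt
    exact ((hc.comp hrad).neg.div_const _).continuousOn
  · refine Continuous.continuousOn ?_
    refine Continuous.div_const (Continuous.div ?_ ?_ hne) _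
    · exact (hq.comp hrad).mul Complex.continuous_ofReal
    · exact Complex.continuous_ofReal.comp hrad
  · intro r _
    have h1 : HasDerivAt (fun r : ℝ => z ^ 2 + r ^ 2) (2 * r) r := by
      simpa using (hasDerivAt_pow 2 r).const_add (z ^ 2)
    have h2 := (hprim _).scomp r (h1.sqrt (hpos r).ne')
    have h3 := h2.neg.div_const (4 * (Real.pi : ℂ))
    refine h3.congr_deriv ?_
    have := hne r
    simp only [Complex.real_smul]
    push_cast
    field_simp
  · intro r hr
    simp [hzero _ (hbig r hr)]
  · intro r hr
    simp [h0 _ (hbig r hr)]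

/-- Cartesian coordinates `ℝ × ℝ² ≃ ℝ³`. -/
def sliceEquiv : ℝ × EuclideanSpace ℝ (Fin 2) ≃ᵐ E3 :=
  (((MeasurableEquiv.refl ℝ).prodCongr (MeasurableEquiv.toLp 2 (Fin 2 → ℝ)).symm).trans
    (MeasurableEquiv.piFinSuccAbove (fun _ : Fin 3 => ℝ) 0).symm).trans
      (MeasurableEquiv.toLp 2 (Fin 3 → ℝ))

theorem measurePreserving_sliceEquiv :
    MeasurePreserving sliceEquiv ((volume : Measure ℝ).prod volume) volume :=
  (((MeasurePreserving.id volume).prod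
      (EuclideanSpace.volume_preserving_symm_measurableEquiv_toLp (Fin 2))).trans
    ((volume_preserving_piFinSuccAbove (fun _ : Fin 3 => ℝ) 0).symm _)).trans
      (PiLp.volume_preserving_toLp (Fin 3))

theorem sliceEquiv_apply_zero (p : ℝ × EuclideanSpace ℝ (Fin 2)) : sliceEquiv p 0 = p.1 := rfl

theorem norm_sliceEquiv (p : ℝ × EuclideanSpace ℝ (Fin 2)) :
    ‖sliceEquiv p‖ = Real.sqrt (p.1 ^ 2 + ‖p.2‖ ^ 2) := by
  rw [EuclideanSpace.norm_eq, EuclideanSpace.norm_sq_eq, Fin.sum_univ_succ]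
  simp only [sliceEquiv_apply_zero, Real.norm_eq_abs, sq_abs]
  rfl

/-- Averaging the integrand over `a` and `-a` turns the exponential into a cosine; polar coordinates
in dimension one then fold the line onto the half-line. -/
theorem integral_even_char {Q : ℝ → ℂ} {k : ℝ}
    (hi : Integrable fun a : ℝ => Complex.exp (-(k * a) * Complex.I) * Q |a|) :
    ∫ a : ℝ, Complex.exp (-(k * a) * Complex.I) * Q |a| =
      2 * ∫ a in Set.Ioi (0 : ℝ), (Real.cos (k * a) : ℂ) * Q a := by
  set G : ℝ → ℂ := fun a => Complex.exp (-(k * a) * Complex.I) * Q |a| with hG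
  have h1 : ∫ a, G (-a) = ∫ a, G a := integral_neg_eq_self G volume
  have h2 : ∫ a, G a + G (-a) = 2 * ∫ a, G a := by
    rw [integral_add hi hi.comp_neg, h1, two_mul]
  have h3 : (fun a => G a + G (-a)) = fun a : ℝ => 2 * ((Real.cos (k * |a|) : ℂ) * Q |a|) := by
    ext a
    have : Real.cos (k * |a|) = Real.cos (k * a) := by
      rcases abs_choice a with h | h <;> rw [h]
      rw [mul_neg, Real.cos_neg]
    rw [this, Complex.ofReal_cos, Complex.cos, hG]
    simp only [abs_neg]
    push_cast
    simp only [mul_neg, neg_neg]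
    ring
  have h4 := integral_fun_norm_addHaar (volume : Measure ℝ)
    fun a : ℝ => ((Real.cos (k * a) : ℝ) : ℂ) * Q a
  simp only [Module.finrank_self, tsub_self, pow_zero, one_smul, Real.norm_eq_abs] at h4
  rw [h3, integral_const_mul, h4] at h2
  rw [← mul_left_cancel₀ two_ne_zero h2]
  simp [Measure.real]

/-- The reflection in the hyperplane orthogonal to `ξ - η` exchanges the two vectors. -/
theorem exists_linearIsometryEquiv_map_eq (ξ η : E3) (h : ‖ξ‖ = ‖η‖) :
    ∃ A : E3 ≃ₗᵢ[ℝ] E3, A ξ = η :=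
  ⟨(Submodule.span ℝ {ξ - η})ᗮ.reflection, Submodule.reflection_sub h⟩

/-- By Fubini, the character is constant on planes orthogonal to the axis, and each plane
contributes half the tail integral of `q`. Integrating the resulting cosine transform by parts
recovers `q` against a sine. -/
theorem fourier_radialKernel_axis {q : ℝ → ℂ} {L : ℝ} (hq : Continuous q)
    (h0 : ∀ r, L ≤ r → q r = 0) {t : ℝ} (ht : 0 < t) :
    𝓕 (radialKernel q) (EuclideanSpace.single 0 t) =
      ∫ r in Set.Ioi 0, ((Real.sin (2 * Real.pi * t * r) / (2 * Real.pi * t) : ℝ) : ℂ) * q r := by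
  have hprim := hasDerivAt_tailIntegral L hq
  set Q : ℝ → ℂ := fun t => ∫ r in t..L, q r
  have hQc : Continuous Q := continuous_iff_continuousAt.2 fun t => (hprim t).continuousAt
  have hQ0 : ∀ t, L ≤ t → Q t = 0 := fun t => tailIntegral_eq_zero h0
  set k : ℝ := 2 * Real.pi * t with hk
  have hkpos : 0 < k := by positivity
  have hint : Integrable (fun x : E3 => Complex.exp (-(k * x 0) * Complex.I) * radialKernel q x) := by
    refine (integrable_radialKernel hq h0).bdd_mul (c := 1) ?_ ?_
    · exact Continuous.aestronglyMeasurable (by fun_prop)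
    · filter_upwards with x
      rw [show (-(k * x 0) * Complex.I : ℂ) = ((-(k * x 0) : ℝ) : ℂ) * Complex.I by push_cast; rfl,
        Complex.norm_exp_ofReal_mul_I]
  have e1 : 𝓕 (radialKernel q) (EuclideanSpace.single 0 t) =
      ∫ x : E3, Complex.exp (-(k * x 0) * Complex.I) * radialKernel q x := by
    rw [Real.fourier_eq']
    congr 1
    ext x
    rw [EuclideanSpace.inner_single_right, smul_eq_mul, hk]
    congr 2
    push_cast
    simp
    ring
  have hint' := (measurePreserving_sliceEquiv.integrable_comp_emb
    sliceEquiv.measurableEmbedding).2 hint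
  rw [e1, ← measurePreserving_sliceEquiv.integral_comp']
  simp only [Function.comp_def] at hint'
  rw [integral_prod _ hint']
  have e2 : ∀ a : ℝ, a ≠ 0 → ∫ y : EuclideanSpace ℝ (Fin 2),
      Complex.exp (-(k * sliceEquiv (a, y) 0) * Complex.I) * radialKernel q (sliceEquiv (a, y)) =
      Complex.exp (-(k * a) * Complex.I) * ((1 / 2) * Q |a|) := by
    intro a ha
    simp only [sliceEquiv_apply_zero, radialKernel, norm_sliceEquiv]
    rw [integral_const_mul, integral_plane hq h0 ha]
  have hae : ∀ᵐ a : ℝ, a ≠ 0 := by simp [ae_iff]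
  have e3 := integral_congr_ae (hae.mono e2)
  have hint2 : Integrable fun a : ℝ => Complex.exp (-(k * a) * Complex.I) * ((1 / 2) * Q |a|) :=
    hint'.integral_prod_left.congr (hae.mono e2)
  rw [e3, integral_even_char (Q := fun a => (1 / 2) * Q a) hint2,
    ← integral_const_mul]
  -- No boundary term survives: the sine vanishes at `0` and the tail integral from `L` on.
  have key := integral_Ioi_deriv_of_eq_zero (L := L)
    (F := fun r : ℝ => ((Real.sin (k * r) / k : ℝ) : ℂ) * Q r)
    (F' := fun r : ℝ => (Real.cos (k * r) : ℂ) * Q r - ((Real.sin (k * r) / k : ℝ) : ℂ) * q r)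
    (by fun_prop) (by fun_prop) ?_ ?_ ?_
  · rw [integral_sub, sub_eq_iff_eq_add] at key
    · simp only [mul_zero, Real.sin_zero, zero_div, Complex.ofReal_zero, zero_mul, neg_zero,
        zero_add] at key
      rw [← key]
      congr 1
      ext a
      ring
    · exact integrableOn_Ioi_of_eq_zero (L := L) (by fun_prop) fun r hr => by simp [hQ0 r hr]
    · exact integrableOn_Ioi_of_eq_zero (L := L) (by fun_prop) fun r hr => by simp [h0 r hr]
  · intro r _
    have h1 : HasDerivAt (fun r : ℝ => Real.sin (k * r) / k) (Real.cos (k * r)) r := by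
      have := (((hasDerivAt_id r).const_mul k).sin).div_const k
      simpa [hkpos.ne'] using this
    refine (h1.ofReal_comp.mul (hprim r)).congr_deriv ?_
    ring
  · intro r hr
    simp [hQ0 r hr]
  · intro r hr
    simp [hQ0 r hr, h0 r hr]

/-- The Fourier transform of `q(‖x‖) / (4π‖x‖)` as a sine transform. -/
theorem fourier_radialKernel {q : ℝ → ℂ} {L : ℝ} (hq : Continuous q)
    (h0 : ∀ r, L ≤ r → q r = 0) {ξ : E3} (hξ : ξ ≠ 0) :
    𝓕 (radialKernel q) ξ = ∫ r in Set.Ioi 0,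
      ((Real.sin (2 * Real.pi * ‖ξ‖ * r) / (2 * Real.pi * ‖ξ‖) : ℝ) : ℂ) * q r := by
  obtain ⟨A, hA⟩ := exists_linearIsometryEquiv_map_eq ξ (EuclideanSpace.single 0 ‖ξ‖) (by simp)
  rw [← fourier_radialKernel_axis hq h0 (norm_pos_iff.2 hξ), ← hA,
    ← Real.fourier_comp_linearIsometry]
  refine congrArg (fun f : E3 → ℂ => 𝓕 f ξ) (funext fun x => ?_)
  simp [radialKernel]

/-! ### Exponential integrals and derivatives of the cut-off. -/

/-- The integral `I` satisfies `I ≤ L` and `a I ≤ 1`; add the two. This is the source of every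
factor `1/(1 + Re ζ)`, uniformly down to `Re ζ = 0`. -/
theorem integral_exp_neg_le {a L : ℝ} (ha : 0 ≤ a) (hL : 0 ≤ L) :
    ∫ r in (0 : ℝ)..L, Real.exp (-a * r) ≤ (L + 1) / (1 + a) := by
  have hint : IntervalIntegrable (fun r => Real.exp (-a * r)) volume 0 L :=
    Continuous.intervalIntegrable (by fun_prop) _ _
  have h1 : ∫ r in (0 : ℝ)..L, Real.exp (-a * r) ≤ L := by
    have := intervalIntegral.integral_mono_on hL hint
      (intervalIntegrable_const (c := (1 : ℝ))) fun r hr => Real.exp_le_one_iff.2 <| by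
        nlinarith [mul_nonneg ha hr.1]
    simpa using this
  have h2 : ∫ r in (0 : ℝ)..L, a * Real.exp (-a * r) ≤ 1 := by
    rw [intervalIntegral.integral_eq_sub_of_hasDerivAt (f := fun r => -Real.exp (-a * r)) _
      (hint.const_mul a)]
    · simpa using (Real.exp_pos _).le
    · intro r _
      have := (((hasDerivAt_id r).const_mul (-a)).exp).neg
      refine this.congr_deriv ?_
      simp
      ring
  rw [intervalIntegral.integral_const_mul] at h2
  rw [le_div_iff₀ (by positivity)]
  linarith

theorem norm_integral_Ioi_le {g : ℝ → ℂ} {a L c : ℝ} (ha : 0 ≤ a) (hL : 0 ≤ L) (hc : 0 ≤ c)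
    (hb : ∀ r, 0 < r → r < L → ‖g r‖ ≤ c * Real.exp (-a * r)) (h0 : ∀ r, L ≤ r → g r = 0) :
    ‖∫ r in Set.Ioi 0, g r‖ ≤ c * ((L + 1) / (1 + a)) := by
  have h1 : ∫ r in Set.Ioi 0, g r = ∫ r in (0 : ℝ)..L, g r := by
    rw [intervalIntegral.integral_of_le hL]
    refine setIntegral_eq_of_subset_of_forall_sdiff_eq_zero measurableSet_Ioi
      Set.Ioc_subset_Ioi_self fun r hr => h0 r ?_
    by_contra! h
    exact hr.2 ⟨hr.1, h.le⟩
  rw [h1]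
  calc _ ≤ ∫ r in (0 : ℝ)..L, c * Real.exp (-a * r) := by
        refine intervalIntegral.norm_integral_le_of_norm_le hL (.of_forall fun r hr => ?_)
          (Continuous.intervalIntegrable (by fun_prop) _ _)
        rcases hr.2.lt_or_eq with h | h
        · exact hb r hr.1 h
        · rw [h0 r h.ge, norm_zero]
          positivity
    _ ≤ _ := by
        rw [intervalIntegral.integral_const_mul]
        exact mul_le_mul_of_nonneg_left (integral_exp_neg_le ha hL) hc

namespace IsCutoff

variable {R Cμ : ℝ} {μ : ℝ → ℝ}

theorem continuousOn_iteratedDerivWithin (hμ : IsCutoff R Cμ μ) (n : ℕ) :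
    ContinuousOn (iteratedDerivWithin n μ (Set.Ici 0)) (Set.Ici 0) :=
  hμ.contDiffOn.continuousOn_iteratedDerivWithin (by exact_mod_cast le_top) (uniqueDiffOn_Ici 0)

theorem hasDerivAt_iteratedDerivWithin (hμ : IsCutoff R Cμ μ) (n : ℕ) {r : ℝ} (hr : 0 < r) :
    HasDerivAt (iteratedDerivWithin n μ (Set.Ici 0))
      (iteratedDerivWithin (n + 1) μ (Set.Ici 0) r) r := by
  rw [iteratedDerivWithin_succ]
  exact ((hμ.contDiffOn.differentiableOn_iteratedDerivWithin
    (by exact_mod_cast ENat.natCast_lt_top n) (uniqueDiffOn_Ici 0)) r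
      hr.le).hasDerivWithinAt.hasDerivAt (Ici_mem_nhds hr)

theorem iteratedDerivWithin_eq_zero (hμ : IsCutoff R Cμ μ) (hR : 0 < R) (n : ℕ) {r : ℝ}
    (hr : 4 * R < r) : iteratedDerivWithin n μ (Set.Ici 0) r = 0 := by
  induction n generalizing r with
  | zero => simpa using hμ.eq_zero r hr.le
  | succ n ih =>
    refine (hμ.hasDerivAt_iteratedDerivWithin n (by linarith)).unique ?_
    refine (hasDerivAt_const r (0 : ℝ)).congr_of_eventuallyEq ?_
    filter_upwards [Ioi_mem_nhds hr] with x hx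
    exact ih hx

theorem const_nonneg (hμ : IsCutoff R Cμ μ) (hR : 0 < R) : 0 ≤ Cμ := by
  have h := (abs_nonneg _).trans (hμ.deriv_le 0 le_rfl)
  have := mul_nonneg h hR.le
  rwa [div_mul_cancel₀ _ hR.ne'] at this

/-- Vanishing of the derivatives is obtained on the open half-line beyond `4R`, where `μ` is locally
zero; `5R` is a convenient closed threshold inside it. -/
theorem exists_derivs (hμ : IsCutoff R Cμ μ) (hR : 0 < R) : ∃ m₁ m₂ : ℝ → ℝ,
    (∀ r, 0 < r → HasDerivAt μ (m₁ r) r) ∧ (∀ r, 0 < r → HasDerivAt m₁ (m₂ r) r) ∧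
    ContinuousOn m₁ (Set.Ici 0) ∧ ContinuousOn m₂ (Set.Ici 0) ∧
    (∀ r, 5 * R ≤ r → m₁ r = 0) ∧ (∀ r, 5 * R ≤ r → m₂ r = 0) ∧
    (∀ r, 0 ≤ r → |m₁ r| ≤ Cμ / R) ∧ ∀ r, 0 ≤ r → |m₂ r| ≤ Cμ / R ^ 2 := by
  refine ⟨iteratedDerivWithin 1 μ (Set.Ici 0), iteratedDerivWithin 2 μ (Set.Ici 0),
    fun r hr => ?_, fun r hr => hμ.hasDerivAt_iteratedDerivWithin 1 hr,
    hμ.continuousOn_iteratedDerivWithin 1, hμ.continuousOn_iteratedDerivWithin 2,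
    fun r hr => hμ.iteratedDerivWithin_eq_zero hR 1 (by linarith),
    fun r hr => hμ.iteratedDerivWithin_eq_zero hR 2 (by linarith), ?_, hμ.deriv_two_le⟩
  · simpa using hμ.hasDerivAt_iteratedDerivWithin 0 hr
  · rw [iteratedDerivWithin_one]
    exact hμ.deriv_le

end IsCutoff

/-! ### The symbol of the truncated kernel and its bounds. -/

/-- The radial profile `e^{-sr} μ(r)` of the truncated kernel. -/
def cutProfile (μ : ℝ → ℝ) (s : ℂ) (r : ℝ) : ℂ := Complex.exp (-s * r) * (μ |r| : ℂ)

theorem cutKernel_eq_radialKernel (μ : ℝ → ℝ) (s : ℂ) :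
    cutKernel μ s = radialKernel (cutProfile μ s) := by
  ext x
  simp only [cutKernel, kernel, radialKernel, cutProfile, abs_norm]
  ring

/-- The profile uses `μ |r|` because `μ` is controlled only on `[0, ∞)`, while the radial lemmas ask
for continuity on all of `ℝ`. -/
theorem continuous_cutProfile {R Cμ : ℝ} {μ : ℝ → ℝ} (hμ : IsCutoff R Cμ μ) (s : ℂ) :
    Continuous (cutProfile μ s) := by
  have : Continuous fun r : ℝ => μ |r| :=
    hμ.contDiffOn.continuousOn.comp_continuous continuous_abs fun r => abs_nonneg r
  unfold cutProfile
  exact Continuous.mul (by fun_prop) (Complex.continuous_ofReal.comp this)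

theorem cutProfile_eq_zero {R Cμ : ℝ} {μ : ℝ → ℝ} (hμ : IsCutoff R Cμ μ) (s : ℂ) {r : ℝ}
    (hr : 4 * R ≤ r) : cutProfile μ s r = 0 := by
  simp [cutProfile, hμ.eq_zero |r| (hr.trans (le_abs_self r))]

/-- The Fourier symbol of the truncated kernel, as a function of the angular frequency. -/
def cutSymbol (μ : ℝ → ℝ) (s : ℂ) (k : ℝ) : ℂ :=
  ∫ r in Set.Ioi 0, ((Real.sin (k * r) / k : ℝ) : ℂ) * cutProfile μ s r

theorem fourier_cutKernel {R Cμ : ℝ} {μ : ℝ → ℝ} (hμ : IsCutoff R Cμ μ) (s : ℂ) {ξ : E3}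
    (hξ : ξ ≠ 0) : 𝓕 (cutKernel μ s) ξ = cutSymbol μ s (2 * Real.pi * ‖ξ‖) := by
  rw [cutKernel_eq_radialKernel]
  exact fourier_radialKernel (continuous_cutProfile hμ s) (fun r => cutProfile_eq_zero hμ s) hξ

theorem cutSymbol_eq (μ : ℝ → ℝ) (s : ℂ) (k : ℝ) : cutSymbol μ s k =
    ∫ r in Set.Ioi 0, ((Real.sin (k * r) / k : ℝ) : ℂ) * (Complex.exp (-s * r) * (μ r : ℂ)) :=
  setIntegral_congr_fun measurableSet_Ioi fun r (hr : 0 < r) => by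
    simp only [cutProfile, abs_of_pos hr]

theorem hasDerivAt_sin_div {k : ℝ} (hk : 0 < k) (r : ℝ) :
    HasDerivAt (fun r : ℝ => ((Real.sin (k * r) / k : ℝ) : ℂ)) (Real.cos (k * r) : ℂ) r := by
  have := (((hasDerivAt_id r).const_mul k).sin).div_const k
  exact HasDerivAt.ofReal_comp (by simpa [hk.ne'] using this)

theorem hasDerivAt_cos_ofReal (k r : ℝ) :
    HasDerivAt (fun r : ℝ => ((Real.cos (k * r) : ℝ) : ℂ)) (-(k * Real.sin (k * r) : ℝ) : ℂ) r := by
  have := ((hasDerivAt_id r).const_mul k).cos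
  have h := HasDerivAt.ofReal_comp this
  refine h.congr_deriv ?_
  simp
  ring

theorem hasDerivAt_exp_neg_mul (s : ℂ) (r : ℝ) :
    HasDerivAt (fun r : ℝ => Complex.exp (-s * r)) (-s * Complex.exp (-s * r)) r := by
  have := ((Complex.ofRealCLM.hasDerivAt (x := r)).const_mul (-s)).cexp
  refine this.congr_deriv ?_
  simp
  ring

theorem norm_exp_neg_mul (s : ℂ) (r : ℝ) : ‖Complex.exp (-s * r)‖ = Real.exp (-s.re * r) := by
  simp [Complex.norm_exp]

theorem norm_sin_div_le {k r : ℝ} (hk : 0 < k) (hr : 0 ≤ r) :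
    ‖((Real.sin (k * r) / k : ℝ) : ℂ)‖ ≤ r := by
  rw [Complex.norm_real, Real.norm_eq_abs, abs_div, abs_of_pos hk, div_le_iff₀ hk, mul_comm r]
  exact (Real.abs_sin_le_abs).trans (abs_of_nonneg (by positivity)).le

/-- The factor `k` cancels the denominator of `sin(kr)/k`, and `|sin| ≤ 1` leaves the exponential
integral. -/
theorem mul_norm_cutSymbol_le {R Cμ : ℝ} {μ : ℝ → ℝ} (hμ : IsCutoff R Cμ μ) (hR : 0 < R) {s : ℂ}
    (hs : 0 ≤ s.re) {k : ℝ} (hk : 0 < k) :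
    k * ‖cutSymbol μ s k‖ ≤ (5 * R + 1) / (1 + s.re) := by
  have h : (k : ℂ) * cutSymbol μ s k =
      ∫ r in Set.Ioi 0, (Real.sin (k * r) : ℂ) * (Complex.exp (-s * r) * (μ r : ℂ)) := by
    rw [cutSymbol_eq, ← integral_const_mul]
    congr 1
    ext r
    have : (k : ℂ) ≠ 0 := by exact_mod_cast hk.ne'
    push_cast
    field_simp
  calc k * ‖cutSymbol μ s k‖ = ‖(k : ℂ) * cutSymbol μ s k‖ := by
        rw [norm_mul, Complex.norm_real, Real.norm_of_nonneg hk.le]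
    _ ≤ 1 * ((5 * R + 1) / (1 + s.re)) := ?_
    _ = _ := one_mul _
  rw [h]
  refine norm_integral_Ioi_le hs (by positivity) zero_le_one (fun r hr _ => ?_) fun r hr => ?_
  · rw [norm_mul, norm_mul, norm_exp_neg_mul, Complex.norm_real, Complex.norm_real,
      Real.norm_of_nonneg (hμ.nonneg r hr.le)]
    have h1 : ‖Real.sin (k * r)‖ ≤ 1 := Real.abs_sin_le_one _
    refine mul_le_mul h1 ?_ (by have := hμ.nonneg r hr.le; positivity) zero_le_one
    exact mul_le_of_le_one_right (Real.exp_pos _).le (hμ.le_one r hr.le)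
  · simp [hμ.eq_zero r (by linarith)]

/-- Since `s e^{-sr}` is minus the derivative of `e^{-sr}`, integration by parts absorbs `s` without
boundary terms. The derivative falls on the sine (giving `1`) or on `μ` (giving `5R · Cμ/R`). -/
theorem norm_mul_norm_cutSymbol_le {R Cμ : ℝ} {μ : ℝ → ℝ} (hμ : IsCutoff R Cμ μ) (hR : 0 < R) {s : ℂ}
    (hs : 0 ≤ s.re) {k : ℝ} (hk : 0 < k) :
    ‖s‖ * ‖cutSymbol μ s k‖ ≤ (1 + 5 * Cμ) * ((5 * R + 1) / (1 + s.re)) := by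
  have hC := hμ.const_nonneg hR
  obtain ⟨m₁, m₂, hd, -, hc₁, -, hz₁, -, hb₁, -⟩ := hμ.exists_derivs hR
  have hc : ContinuousOn (fun r => (μ r : ℂ)) (Set.Ici 0) :=
    Complex.continuous_ofReal.comp_continuousOn hμ.contDiffOn.continuousOn
  replace hc₁ : ContinuousOn (fun r => (m₁ r : ℂ)) (Set.Ici 0) :=
    Complex.continuous_ofReal.comp_continuousOn hc₁
  have hz : ∀ r, 5 * R ≤ r → μ r = 0 := fun r hr => hμ.eq_zero r (by linarith)
  have key := integral_Ioi_deriv_of_eq_zero (L := 5 * R)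
    (F := fun r : ℝ => -(((Real.sin (k * r) / k : ℝ) : ℂ) * Complex.exp (-s * r) * (μ r : ℂ)))
    (F' := fun r : ℝ => s * (((Real.sin (k * r) / k : ℝ) : ℂ) *
      (Complex.exp (-s * r) * (μ r : ℂ))) - Complex.exp (-s * r) *
        ((Real.cos (k * r) : ℂ) * μ r + ((Real.sin (k * r) / k : ℝ) : ℂ) * m₁ r))
    (by fun_prop) (by fun_prop) ?_ ?_ ?_
  · rw [integral_sub, integral_const_mul, ← cutSymbol_eq] at key
    · simp only [mul_zero, Real.sin_zero, zero_div, Complex.ofReal_zero, zero_mul, neg_zero,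
        sub_eq_zero] at key
      rw [← norm_mul, key]
      refine norm_integral_Ioi_le hs (by positivity) (by positivity) (fun r hr hr5 => ?_)
        fun r hr => ?_
      · rw [norm_mul, norm_exp_neg_mul, mul_comm]
        refine mul_le_mul_of_nonneg_right ((norm_add_le _ _).trans ?_) (Real.exp_pos _).le
        rw [norm_mul, norm_mul]
        have h1 : ‖(Real.cos (k * r) : ℂ)‖ ≤ 1 := by
          rw [Complex.norm_real]
          exact Real.abs_cos_le_one _
        have h2 : ‖(μ r : ℂ)‖ ≤ 1 := by
          rw [Complex.norm_real, Real.norm_of_nonneg (hμ.nonneg r hr.le)]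
          exact hμ.le_one r hr.le
        have h3 := (norm_sin_div_le hk hr.le).trans hr5.le
        have h4 : ‖(m₁ r : ℂ)‖ ≤ Cμ / R := by
          rw [Complex.norm_real]
          exact hb₁ r hr.le
        have h5 : 5 * R * (Cμ / R) = 5 * Cμ := by field_simp
        rw [← h5]
        exact add_le_add (mul_le_one₀ h1 (norm_nonneg _) h2)
          (mul_le_mul h3 h4 (norm_nonneg _) (by positivity))
      · simp [hz r hr, hz₁ r hr]
    · exact integrableOn_Ioi_of_eq_zero (L := 5 * R) (by fun_prop) fun r hr => by simp [hz r hr]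
    · exact integrableOn_Ioi_of_eq_zero (L := 5 * R) (by fun_prop)
        fun r hr => by simp [hz r hr, hz₁ r hr]
  · intro r hr
    refine (((hasDerivAt_sin_div hk r).mul (hasDerivAt_exp_neg_mul s r)).mul
      (hd r hr).ofReal_comp).neg.congr_deriv ?_
    simp only [Pi.mul_apply]
    ring
  · intro r hr
    simp [hz r hr]
  · intro r hr
    simp [hz r hr, hz₁ r hr]

/-- Up to terms in `μ'` and `μ''` the integrand is an exact derivative. The boundary value `1` at `r
= 0` is the delta mass of the fundamental solution; having no decay in `Re s`, it makes the decay of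
the other term useless. -/
theorem norm_sq_add_sq_mul_cutSymbol_le {R Cμ : ℝ} {μ : ℝ → ℝ} (hμ : IsCutoff R Cμ μ) (hR : 0 < R) {s : ℂ}
    (hs : 0 ≤ s.re) {k : ℝ} (hk : 0 < k) :
    ‖((k : ℂ) ^ 2 + s ^ 2) * cutSymbol μ s k‖ ≤ 1 + 7 * Cμ / R * (5 * R + 1) := by
  have hC := hμ.const_nonneg hR
  obtain ⟨m₁, m₂, hd, hd₁, hc₁, hc₂, hz₁, hz₂, hb₁, hb₂⟩ := hμ.exists_derivs hR
  have hc : ContinuousOn (fun r => (μ r : ℂ)) (Set.Ici 0) :=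
    Complex.continuous_ofReal.comp_continuousOn hμ.contDiffOn.continuousOn
  replace hc₁ : ContinuousOn (fun r => (m₁ r : ℂ)) (Set.Ici 0) :=
    Complex.continuous_ofReal.comp_continuousOn hc₁
  replace hc₂ : ContinuousOn (fun r => (m₂ r : ℂ)) (Set.Ici 0) :=
    Complex.continuous_ofReal.comp_continuousOn hc₂
  have hz : ∀ r, 5 * R ≤ r → μ r = 0 := fun r hr => hμ.eq_zero r (by linarith)
  have hk' : (k : ℂ) ≠ 0 := by exact_mod_cast hk.ne'
  -- This primitive is chosen so that the terms `s μ'` cancel on differentiation; the remainder is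
  -- therefore bounded uniformly in `s`.
  have key := integral_Ioi_deriv_of_eq_zero (L := 5 * R)
    (F := fun r : ℝ => -(Complex.exp (-s * r) * ((Real.cos (k * r) : ℂ) * μ r +
      ((Real.sin (k * r) / k : ℝ) : ℂ) * (s * μ r + m₁ r))))
    (F' := fun r : ℝ => ((k : ℂ) ^ 2 + s ^ 2) * (((Real.sin (k * r) / k : ℝ) : ℂ) *
      (Complex.exp (-s * r) * (μ r : ℂ))) - Complex.exp (-s * r) *
        (2 * (Real.cos (k * r) : ℂ) * m₁ r + ((Real.sin (k * r) / k : ℝ) : ℂ) * m₂ r))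
    (by fun_prop) (by fun_prop) ?_ ?_ ?_
  · rw [integral_sub, integral_const_mul, ← cutSymbol_eq] at key
    · have h0 : μ 0 = 1 := hμ.eq_one 0 le_rfl (by positivity)
      simp only [mul_zero, Real.sin_zero, zero_div, Complex.ofReal_zero, zero_mul, h0,
        Complex.exp_zero, Real.cos_zero, Complex.ofReal_one, mul_one, add_zero, neg_neg,
        sub_eq_iff_eq_add] at key
      rw [key]
      refine (norm_add_le _ _).trans ?_
      rw [norm_one]
      refine add_le_add le_rfl ?_
      refine (norm_integral_Ioi_le (c := 7 * Cμ / R) hs (L := 5 * R) (by positivity)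
        (by positivity) (fun r hr hr5 => ?_) fun r hr => ?_).trans ?_
      · rw [norm_mul, norm_exp_neg_mul, mul_comm]
        refine mul_le_mul_of_nonneg_right ((norm_add_le _ _).trans ?_) (Real.exp_pos _).le
        rw [norm_mul, norm_mul, norm_mul, Complex.norm_ofNat]
        have h1 : ‖(Real.cos (k * r) : ℂ)‖ ≤ 1 := by
          rw [Complex.norm_real]
          exact Real.abs_cos_le_one _
        have h3 := (norm_sin_div_le hk hr.le).trans hr5.le
        have h4 : ‖(m₁ r : ℂ)‖ ≤ Cμ / R := by
          rw [Complex.norm_real]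
          exact hb₁ r hr.le
        have h6 : ‖(m₂ r : ℂ)‖ ≤ Cμ / R ^ 2 := by
          rw [Complex.norm_real]
          exact hb₂ r hr.le
        have h5 : 7 * Cμ / R = 2 * 1 * (Cμ / R) + 5 * R * (Cμ / R ^ 2) := by
          field_simp
          ring
        rw [h5]
        gcongr
      · simp [hz₁ r hr, hz₂ r hr]
      · exact mul_le_mul_of_nonneg_left (div_le_self (by positivity) (by linarith))
          (by positivity)
    · exact integrableOn_Ioi_of_eq_zero (L := 5 * R) (by fun_prop) fun r hr => by simp [hz r hr]
    · exact integrableOn_Ioi_of_eq_zero (L := 5 * R) (by fun_prop)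
        fun r hr => by simp [hz₁ r hr, hz₂ r hr]
  · intro r hr
    have h0 := (hd r hr).ofReal_comp
    have h1 := (hd₁ r hr).ofReal_comp
    refine ((hasDerivAt_exp_neg_mul s r).mul (((hasDerivAt_cos_ofReal k r).mul h0).add
      ((hasDerivAt_sin_div hk r).mul ((h0.const_mul s).add h1)))).neg.congr_deriv ?_
    simp only [Pi.mul_apply, Pi.add_apply]
    push_cast
    field_simp
    ring
  · intro r hr
    simp [hz r hr, hz₁ r hr]
  · intro r hr
    simp [hz r hr, hz₁ r hr, hz₂ r hr]

/-- At high frequencies the truncated resolvent gains two derivatives. -/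
theorem sq_mul_norm_cutSymbol_le_of_high {R Cμ : ℝ} {μ : ℝ → ℝ} (hμ : IsCutoff R Cμ μ) (hR : 0 < R) {s : ℂ}
    (hs : 0 ≤ s.re) {k : ℝ} (hk : 0 < k) {lam : ℝ} (hlam : 1 < lam) (hks : lam * |s.im| ≤ k) :
    k ^ 2 * ‖cutSymbol μ s k‖ ≤ (1 + 7 * Cμ / R * (5 * R + 1)) * (lam / (lam - 1)) := by
  have hC := hμ.const_nonneg hR
  have h := norm_sq_add_sq_mul_cutSymbol_le hμ hR hs hk
  set A := 1 + 7 * Cμ / R * (5 * R + 1)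
  have hA : 0 ≤ A := (norm_nonneg _).trans h
  have h1 : k ^ 2 - s.im ^ 2 ≤ ‖(k : ℂ) ^ 2 + s ^ 2‖ := by
    refine le_trans ?_ (Complex.re_le_norm _)
    have : ((k : ℂ) ^ 2 + s ^ 2).re = k ^ 2 + (s.re ^ 2 - s.im ^ 2) := by
      rw [Complex.add_re, ← Complex.ofReal_pow, Complex.ofReal_re, pow_two s, Complex.mul_re]
      ring
    rw [this]
    nlinarith [sq_nonneg s.re]
  have h2 : (lam * |s.im|) ^ 2 ≤ k ^ 2 := pow_le_pow_left₀ (by positivity) hks 2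
  rw [mul_pow, sq_abs] at h2
  -- Equivalent to `λ (Im s)² ≤ k²`, which is weaker than `h2` as `λ > 1`.
  have h3 : k ^ 2 * (lam - 1) ≤ lam * (k ^ 2 - s.im ^ 2) := by
    nlinarith [sq_nonneg s.im, mul_nonneg (sub_nonneg.2 hlam.le) (sq_nonneg s.im)]
  rw [norm_mul] at h
  have hlam' : 0 < lam - 1 := sub_pos.2 hlam
  rw [← mul_div_assoc, le_div_iff₀ hlam']
  calc k ^ 2 * ‖cutSymbol μ s k‖ * (lam - 1)
      = k ^ 2 * (lam - 1) * ‖cutSymbol μ s k‖ := by ring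
    _ ≤ lam * ‖(k : ℂ) ^ 2 + s ^ 2‖ * ‖cutSymbol μ s k‖ := by
      refine mul_le_mul_of_nonneg_right ?_ (norm_nonneg _)
      exact h3.trans (mul_le_mul_of_nonneg_left h1 (by linarith))
    _ ≤ A * lam := by
      rw [mul_assoc, mul_comm]
      exact mul_le_mul_of_nonneg_right h (by linarith)

/-- The uniform bound for two derivatives. -/
theorem sq_mul_norm_cutSymbol_le {R Cμ : ℝ} {μ : ℝ → ℝ} (hμ : IsCutoff R Cμ μ) (hR : 0 < R) {s : ℂ}
    (hs : 0 ≤ s.re) {k : ℝ} (hk : 0 < k) :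
    k ^ 2 * ‖cutSymbol μ s k‖ ≤ (1 + 7 * Cμ / R * (5 * R + 1) + (1 + 5 * Cμ) * (5 * R + 1)) *
      ((1 + ‖s‖) / (1 + s.re)) := by
  have hC := hμ.const_nonneg hR
  have h1 := norm_sq_add_sq_mul_cutSymbol_le hμ hR hs hk
  have h2 := norm_mul_norm_cutSymbol_le hμ hR hs hk
  have h3 : 1 ≤ (1 + ‖s‖) / (1 + s.re) := by
    rw [one_le_div (by linarith)]
    linarith [Complex.re_le_norm s]
  -- Only one factor of `s²` is absorbed by the first-order bound; the other produces `1 + ‖s‖`.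
  have e : k ^ 2 * ‖cutSymbol μ s k‖ =
      ‖((k : ℂ) ^ 2 + s ^ 2) * cutSymbol μ s k - s ^ 2 * cutSymbol μ s k‖ := by
    rw [← sub_mul, add_sub_cancel_right, norm_mul, norm_pow, Complex.norm_real,
      Real.norm_of_nonneg hk.le]
  rw [e, add_mul (1 + 7 * Cμ / R * (5 * R + 1))]
  refine (norm_sub_le _ _).trans (add_le_add (h1.trans ?_) ?_)
  · exact le_mul_of_one_le_right (by positivity) h3
  · rw [norm_mul, norm_pow, pow_two, mul_assoc]
    calc ‖s‖ * (‖s‖ * ‖cutSymbol μ s k‖)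
        ≤ (1 + ‖s‖) * ((1 + 5 * Cμ) * ((5 * R + 1) / (1 + s.re))) := by
          gcongr
          linarith
      _ = _ := by ring

/-! ### Convolutions: convergence, membership in `L²`, Fourier transform. -/

theorem integrable_mul_comp_sub {f K : E3 → ℂ} (hf : MemLp f 2 volume) (hK : MemLp K 2 volume)
    (x : E3) : Integrable fun t => f t * K (x - t) :=
  hf.integrable_mul (hK.comp_measurePreserving (Measure.measurePreserving_sub_left volume x))

theorem convConverges_of_memLp {K : E3 → ℂ} (hK : MemLp K 2 volume) (φ : L2) :
    ConvConverges K φ := fun x => integrable_mul_comp_sub (Lp.memLp φ) hK x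

theorem norm_conv_le {K : E3 → ℂ} (hK : MemLp K 2 volume) (φ : L2) (x : E3) :
    ‖conv K φ x‖ ≤ (∫ t, ‖φ t‖ ^ 2) + ∫ t, ‖K t‖ ^ 2 := by
  have h1 := integrable_norm_sq φ
  have h2 : Integrable fun t => ‖K (x - t)‖ ^ 2 :=
    (hK.comp_measurePreserving (Measure.measurePreserving_sub_left volume x)).integrable_norm_pow
      (by norm_num)
  have h3 : ∫ t, ‖K (x - t)‖ ^ 2 = ∫ t, ‖K t‖ ^ 2 :=
    integral_sub_left_eq_self (fun t => ‖K t‖ ^ 2) volume x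
  rw [← h3, ← integral_add h1 h2]
  refine norm_integral_le_of_norm_le (h1.add h2) (.of_forall fun t => ?_)
  simp only [ContinuousLinearMap.mul_apply', norm_mul]
  nlinarith [sq_nonneg (‖φ t‖ - ‖K (x - t)‖), sq_nonneg ‖φ t‖, sq_nonneg ‖K (x - t)‖]

theorem memLp_two_of_integrable_of_bounded {f : E3 → ℂ} {B : ℝ} (hf : Integrable f)
    (hB : ∀ x, ‖f x‖ ≤ B) : MemLp f 2 volume := by
  rw [memLp_two_iff_integrable_sq_norm hf.aestronglyMeasurable]
  refine (hf.norm.const_mul B).mono' (hf.aestronglyMeasurable.norm.pow 2) (.of_forall fun x => ?_)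
  rw [norm_pow, norm_norm, pow_two]
  exact mul_le_mul_of_nonneg_right (hB x) (norm_nonneg _)

theorem SupportedInBall.integrable {R : ℝ} {φ : L2} (h : SupportedInBall R φ) :
    Integrable (φ : E3 → ℂ) := by
  have h1 : IntegrableOn (φ : E3 → ℂ) (Metric.ball 0 R) :=
    have : IsFiniteMeasure ((volume : Measure E3).restrict (Metric.ball 0 R)) :=
      ⟨by simpa using measure_ball_lt_top (μ := (volume : Measure E3)) (x := 0) (r := R)⟩
    ((Lp.memLp φ).restrict _).integrable (by norm_num)
  exact h1.integrable_of_ae_notMem_eq_zero h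

/-- An `L¹ * L¹` convolution is integrable and an `L² * L²` one is bounded; together they give `L²`.
Only membership matters here, as sharp norms come from the symbol. -/
theorem memLp_conv {K : E3 → ℂ} (h1 : Integrable K) (h2 : MemLp K 2 volume) {φ : L2}
    (hφ : Integrable (φ : E3 → ℂ)) : MemLp (conv K φ) 2 volume :=
  memLp_two_of_integrable_of_bounded (hφ.integrable_convolution _ h1) (norm_conv_le h2 φ)

theorem fourier_conv_ae_eq {K : E3 → ℂ} (h1 : Integrable K) (h2 : MemLp K 2 volume) {φ : L2}
    (hφ : Integrable (φ : E3 → ℂ)) :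
    (𝓕 (memLp_conv h1 h2 hφ).toLp : L2) =ᵐ[volume] fun ξ => 𝓕 K ξ * (𝓕 φ : L2) ξ := by
  have e1 := fourier_toLp_ae_eq (hφ.integrable_convolution (ContinuousLinearMap.mul ℂ ℂ) h1)
    (memLp_conv h1 h2 hφ)
  have e2 := fourier_toLp_ae_eq hφ (Lp.memLp φ)
  rw [Lp.toLp_coeFn] at e2
  filter_upwards [e1, e2] with ξ hξ1 hξ2
  exact hξ1.trans (by rw [hξ2, Real.fourier_mul_convolution_eq hφ h1, mul_comm])

section CutKernel

variable {R Cμ : ℝ} {μ : ℝ → ℝ}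

theorem integrable_cutKernel (hμ : IsCutoff R Cμ μ) (s : ℂ) : Integrable (cutKernel μ s) := by
  rw [cutKernel_eq_radialKernel]
  exact integrable_radialKernel (continuous_cutProfile hμ s) fun r => cutProfile_eq_zero hμ s

theorem memLp_cutKernel (hμ : IsCutoff R Cμ μ) (s : ℂ) : MemLp (cutKernel μ s) 2 volume := by
  rw [cutKernel_eq_radialKernel]
  exact memLp_radialKernel (continuous_cutProfile hμ s) fun r => cutProfile_eq_zero hμ s

theorem fourier_conv_cutKernel (hμ : IsCutoff R Cμ μ) (s : ℂ) {φ : L2}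
    (hφ : Integrable (φ : E3 → ℂ)) (hz : MemLp (conv (cutKernel μ s) φ) 2 volume) :
    ∀ᵐ ξ : E3, 0 < 2 * Real.pi * ‖ξ‖ ∧
      (𝓕 hz.toLp : L2) ξ = cutSymbol μ s (2 * Real.pi * ‖ξ‖) * (𝓕 φ : L2) ξ := by
  have hne : ∀ᵐ ξ : E3, ξ ≠ 0 := by simp [ae_iff]
  filter_upwards [fourier_conv_ae_eq (integrable_cutKernel hμ s) (memLp_cutKernel hμ s) hφ, hne]
    with ξ hξ h0
  refine ⟨by positivity, ?_⟩
  rw [← fourier_cutKernel hμ s h0, ← hξ]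

theorem convConverges_kernel (s : ℂ) {φ : L2} (hφ : SupportedInBall R φ) :
    ConvConverges (kernel s) φ := by
  intro x
  set T := ‖x‖ + R
  -- For `Re s = 0` the full kernel is not in `L²`. With `x` fixed and `t` in the ball, only radii
  -- up to `T` occur, so a plateau equal to `1` up to `T` and `0` from `T + 1` changes nothing.
  have hmem : MemLp (radialKernel fun r : ℝ =>
      Complex.exp (-s * r) * ((max 0 (min 1 (T + 1 - r)) : ℝ) : ℂ)) 2 volume := by
    refine memLp_radialKernel (L := T + 1) (by fun_prop) fun r hr => ?_
    rw [max_eq_left ((min_le_right _ _).trans (by linarith))]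
    simp
  refine (integrable_mul_comp_sub (Lp.memLp φ) hmem x).congr ?_
  filter_upwards [hφ] with t ht
  by_cases hb : t ∈ Metric.ball (0 : E3) R
  · have h1 : ‖x - t‖ ≤ T := (norm_sub_le _ _).trans (by
      have := mem_ball_zero_iff.1 hb
      simp only [T]
      linarith)
    have h2 : max 0 (min 1 (T + 1 - ‖x - t‖)) = 1 := by
      rw [min_eq_left (by linarith), max_eq_right zero_le_one]
    simp [radialKernel, kernel, h2]
  · simp [ht hb]

theorem conv_kernel_eq_conv_cutKernel (hμ : IsCutoff R Cμ μ) (s : ℂ) {φ : L2}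
    (hφ : SupportedInBall R φ) {x : E3} (hx : x ∈ Metric.ball (0 : E3) R) :
    conv (kernel s) φ x = conv (cutKernel μ s) φ x := by
  refine integral_congr_ae ?_
  filter_upwards [hφ] with t ht
  by_cases hb : t ∈ Metric.ball (0 : E3) R
  · have h1 : ‖x - t‖ ≤ 2 * R := (norm_sub_le _ _).trans (by
      have := mem_ball_zero_iff.1 hb
      have := mem_ball_zero_iff.1 hx
      linarith)
    simp [cutKernel, hμ.eq_one _ (norm_nonneg _) h1]
  · simp [ht hb]

end CutKernel

/-! ### Weighted norm, frequency projections and powers of the frequency. -/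

theorem weightedNorm_le {ρ X Y : ℝ} {f : L2} (hρ : 0 ≤ ρ) (hX : 0 ≤ X) (hY : 0 ≤ Y)
    (hg : gradNorm 1 f ≤ ENNReal.ofReal X) (hf : ρ * ‖f‖ ≤ Y) :
    weightedNorm ρ f ≤ ENNReal.ofReal (X + Y) := by
  have h1 : gradNorm 1 f ^ 2 + ENNReal.ofReal (ρ ^ 2 * ‖f‖ ^ 2) ≤
      ENNReal.ofReal (X + Y) ^ 2 := by
    calc _ ≤ ENNReal.ofReal X ^ 2 + ENNReal.ofReal (Y ^ 2) := by
          gcongr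
          rw [← mul_pow]
          gcongr
      _ = ENNReal.ofReal (X ^ 2 + Y ^ 2) := by
          rw [← ENNReal.ofReal_pow hX, ← ENNReal.ofReal_add (by positivity) (by positivity)]
      _ ≤ ENNReal.ofReal ((X + Y) ^ 2) := ENNReal.ofReal_le_ofReal (by nlinarith)
      _ = _ := ENNReal.ofReal_pow (by positivity) _
  refine (ENNReal.rpow_le_rpow h1 (by norm_num)).trans ?_
  rw [← ENNReal.rpow_natCast, ← ENNReal.rpow_mul]
  norm_num

/-- The Fourier projection of `f` to the frequencies in `S`. -/
def freqCut (S : Set E3) (hS : MeasurableSet S) (f : L2) : L2 :=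
  𝓕⁻ (((Lp.memLp (𝓕 f : L2)).indicator hS).toLp : L2)

theorem fourier_freqCut {S : Set E3} (hS : MeasurableSet S) (f : L2) :
    (𝓕 (freqCut S hS f) : L2) =ᵐ[volume] S.indicator (𝓕 f : L2) := by
  rw [freqCut, fourier_fourierInv_eq]
  exact MemLp.coeFn_toLp _

theorem freqCut_add_freqCut_compl {S : Set E3} (hS : MeasurableSet S) (f : L2) :
    freqCut S hS f + freqCut Sᶜ hS.compl f = f := by
  rw [freqCut, freqCut, ← fourierInv_add, ← MemLp.toLp_add]
  simp_rw [Set.indicator_self_add_compl]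
  rw [Lp.toLp_coeFn, fourierInv_fourier_eq]

theorem pow_mul_le_zpow_mul {k δ x y : ℝ} {p : ℕ} (hp : p ≤ 2) (hδ : 0 < δ) (hk : δ ≤ k)
    (hx : 0 ≤ x) (h : k ^ 2 * x ≤ y) : k ^ p * x ≤ δ ^ ((p : ℤ) - 2) * y := by
  obtain ⟨n, hn⟩ := Nat.exists_eq_add_of_le hp
  have e : (p : ℤ) - 2 = -(n : ℤ) := by lia
  rw [e, zpow_neg, zpow_natCast, inv_mul_eq_div, le_div_iff₀ (by positivity)]
  calc k ^ p * x * δ ^ n ≤ k ^ p * x * k ^ n := by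
        have := hδ.trans_le hk
        gcongr
    _ = k ^ 2 * x := by rw [hn, pow_add]; ring
    _ ≤ y := h

theorem pow_mul_le_zpow_mul' {k δ x y : ℝ} {p : ℕ} (hp : 2 ≤ p) (hk0 : 0 ≤ k) (hk : k ≤ δ)
    (hx : 0 ≤ x) (h : k ^ 2 * x ≤ y) : k ^ p * x ≤ δ ^ ((p : ℤ) - 2) * y := by
  obtain ⟨n, rfl⟩ := Nat.exists_eq_add_of_le hp
  have e : ((2 + n : ℕ) : ℤ) - 2 = (n : ℤ) := by push_cast; ring
  rw [e, zpow_natCast]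
  calc k ^ (2 + n) * x = k ^ n * (k ^ 2 * x) := by ring
    _ ≤ δ ^ n * y := by
      have : 0 ≤ k ^ 2 * x := by positivity
      have := hk0.trans hk
      gcongr

/-! ### Stability and the frequency-localised estimates. -/

section Splitting

variable {R Cμ : ℝ} {μ : ℝ → ℝ}

theorem exists_weightedNorm_le (hR : 0 < R) (hμ : IsCutoff R Cμ μ) :
    ∃ C : ℝ, 0 < C ∧ ∀ φ : L2, SupportedInBall R φ → ∀ ζ : ℂ, 0 ≤ ζ.re →
      ∃ hz : MemLp (conv (cutKernel μ (starRingEnd ℂ ζ)) φ) 2 volume,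
        weightedNorm ‖ζ‖ hz.toLp ≤ ENNReal.ofReal (C / (1 + ζ.re) * ‖φ‖) := by
  have hC := hμ.const_nonneg hR
  refine ⟨(5 * R + 1) + (1 + 5 * Cμ) * (5 * R + 1), by positivity, fun φ hφ ζ hζ => ?_⟩
  set s := starRingEnd ℂ ζ
  have hs : 0 ≤ s.re := by simpa [s] using hζ
  have hns : ‖s‖ = ‖ζ‖ := Complex.norm_conj ζ
  have hz := memLp_conv (integrable_cutKernel hμ s) (memLp_cutKernel hμ s) hφ.integrable
  refine ⟨hz, ?_⟩
  have hF := fourier_conv_cutKernel hμ s hφ.integrable hz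
  set X := (5 * R + 1) / (1 + s.re) * ‖φ‖
  set Y := (1 + 5 * Cμ) * ((5 * R + 1) / (1 + s.re)) * ‖φ‖
  have hXY : ((5 * R + 1) + (1 + 5 * Cμ) * (5 * R + 1)) / (1 + ζ.re) * ‖φ‖ = X + Y := by
    simp only [X, Y, s, Complex.conj_re]
    ring
  rw [hXY]
  refine weightedNorm_le (norm_nonneg _) (by positivity) (by positivity) ?_ ?_
  · rw [show X = (5 * R + 1) / (1 + s.re) * ‖(𝓕 φ : L2)‖ by rw [Lp.norm_fourier_eq]]
    refine gradNorm_le_of_fourier (by positivity) ?_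
    filter_upwards [hF] with ξ ⟨hk, hξ⟩
    rw [hξ, norm_mul, pow_one, ← mul_assoc]
    exact mul_le_mul_of_nonneg_right (mul_norm_cutSymbol_le hμ hR hs hk) (norm_nonneg _)
  -- Scaling by `ζ` itself puts the weight `‖ζ‖` inside the norm, where the symbol bound applies
  -- pointwise.
  · have h : ‖ζ • (𝓕 hz.toLp : L2)‖ ≤
        (1 + 5 * Cμ) * ((5 * R + 1) / (1 + s.re)) * ‖(𝓕 φ : L2)‖ := by
      refine Lp.norm_le_mul_norm_of_ae_le_mul ?_
      filter_upwards [hF, Lp.coeFn_smul ζ (𝓕 hz.toLp : L2)] with ξ ⟨hk, hξ⟩ h2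
      rw [h2, Pi.smul_apply, norm_smul, hξ, norm_mul, ← mul_assoc, ← hns]
      exact mul_le_mul_of_nonneg_right (norm_mul_norm_cutSymbol_le hμ hR hs hk) (norm_nonneg _)
    rwa [norm_smul, Lp.norm_fourier_eq, Lp.norm_fourier_eq] at h

/-- A common bound for all frequency-localised estimates of the truncated kernel. -/
def splitConst (R Cμ : ℝ) : ℝ :=
  3 * ((1 + 7 * Cμ / R * (5 * R + 1)) + (1 + 5 * Cμ) * (5 * R + 1))

/-- The case `p = 2` is the high-frequency bound, and lower `p` follow by dividing by powers of `k ≥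
λ|Im s|`. The factor `(‖s‖ / s.im)²` is at least `1` and only weakens the estimate. -/
theorem high_symbol_le (hμ : IsCutoff R Cμ μ) (hR : 0 < R) {s : ℂ} (hs : 0 ≤ s.re)
    (him : s.im ≠ 0) {k : ℝ} (hk : 0 < k) {lam : ℝ} (hlam : 1 < lam) (hks : lam * |s.im| ≤ k)
    {p : ℕ} (hp : p ≤ 2) :
    k ^ p * ‖cutSymbol μ s k‖ ≤ splitConst R Cμ * (lam / (lam - 1)) * (‖s‖ / s.im) ^ 2 *
      (lam * |s.im|) ^ ((p : ℤ) - 2) := by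
  have hC := hμ.const_nonneg hR
  have hδ : 0 < lam * |s.im| := by positivity
  rw [mul_comm]
  have h1 : (1 : ℝ) ≤ (‖s‖ / s.im) ^ 2 := by
    rw [div_pow, one_le_div (by positivity), ← sq_abs s.im]
    exact pow_le_pow_left₀ (abs_nonneg _) (Complex.abs_im_le_norm s) 2
  have h2 : 1 + 7 * Cμ / R * (5 * R + 1) ≤ splitConst R Cμ := by
    have : 0 ≤ 7 * Cμ / R * (5 * R + 1) := by positivity
    have : 0 ≤ (1 + 5 * Cμ) * (5 * R + 1) := by positivity
    unfold splitConst
    linarith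
  have h3 : 0 < lam - 1 := sub_pos.2 hlam
  have h4 : 0 ≤ splitConst R Cμ := le_trans (by positivity) h2
  rw [mul_comm, mul_comm (_ * _ * _)]
  refine pow_mul_le_zpow_mul hp hδ hks (norm_nonneg _)
    ((sq_mul_norm_cutSymbol_le_of_high hμ hR hs hk hlam hks).trans ?_)
  refine le_trans ?_ (le_mul_of_one_le_right (by positivity) h1)
  gcongr

theorem low_symbol_le (hμ : IsCutoff R Cμ μ) (hR : 0 < R) {s : ℂ} (hs : 0 ≤ s.re)
    {k : ℝ} (hk : 0 < k) {lam : ℝ} (hks : k ≤ lam * |s.im|) {p : ℕ} (hp : 2 ≤ p) :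
    k ^ p * ‖cutSymbol μ s k‖ ≤ splitConst R Cμ * ((1 + ‖s‖) / (1 + s.re)) *
      (Real.sqrt 3 * lam * |s.im|) ^ ((p : ℤ) - 2) := by
  have hC := hμ.const_nonneg hR
  rw [mul_comm (_ * _) (_ ^ _)]
  have h3 : 1 ≤ Real.sqrt 3 := Real.one_le_sqrt.2 (by norm_num)
  refine pow_mul_le_zpow_mul' hp hk.le (hks.trans ?_) (norm_nonneg _)
    ((sq_mul_norm_cutSymbol_le hμ hR hs hk).trans ?_)
  · rw [mul_assoc]
    exact le_mul_of_one_le_left (hk.le.trans hks) h3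
  · have : 0 ≤ 7 * Cμ / R * (5 * R + 1) := by positivity
    have : 0 ≤ (1 + 5 * Cμ) * (5 * R + 1) := by positivity
    refine mul_le_mul_of_nonneg_right ?_ (by positivity)
    unfold splitConst
    linarith

/-- The powers of `λ` on the right cancel, so the claim is a bound by `|Im s|^{p-2}` valid at every
frequency; it follows from `|Im s| ≤ ‖s‖` and the two first-order bounds. The negative powers of
`√3` cost at most the `3` in `splitConst`. -/
theorem low_symbol_le' (hμ : IsCutoff R Cμ μ) (hR : 0 < R) {s : ℂ} (hs : 0 ≤ s.re)
    (him : s.im ≠ 0) {k : ℝ} (hk : 0 < k) {lam : ℝ} (hlam : 0 < lam) {p : ℕ} (hp : p ≤ 1) :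
    k ^ p * ‖cutSymbol μ s k‖ ≤ splitConst R Cμ * lam ^ (2 - (p : ℤ)) *
      ((1 + ‖s‖) / (1 + s.re)) * (Real.sqrt 3 * lam * |s.im|) ^ ((p : ℤ) - 2) := by
  have hC := hμ.const_nonneg hR
  have hb : 0 < |s.im| := abs_pos.2 him
  have hbs := Complex.abs_im_le_norm s
  have hA := mul_norm_cutSymbol_le hμ hR hs hk
  have hB := norm_mul_norm_cutSymbol_le hμ hR hs hk
  have h3 : 0 < Real.sqrt 3 := by positivity
  have h33 : Real.sqrt 3 ^ 2 = 3 := Real.sq_sqrt (by norm_num)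
  set A := 5 * R + 1
  have hA0 : 0 < A := by positivity
  have hD : splitConst R Cμ = 3 * (1 + 7 * Cμ / R * A) + 3 * ((1 + 5 * Cμ) * A) := by
    simp only [splitConst, A]
    ring
  have h7 : 0 ≤ 7 * Cμ / R * A := by positivity
  have h5 : 0 ≤ 5 * Cμ * A := by positivity
  have hr : 0 < 1 + s.re := by linarith
  set D := splitConst R Cμ
  have hx := norm_nonneg (cutSymbol μ s k)
  interval_cases p
  · have e : D * lam ^ (2 - ((0 : ℕ) : ℤ)) * ((1 + ‖s‖) / (1 + s.re)) *
        (Real.sqrt 3 * lam * |s.im|) ^ (((0 : ℕ) : ℤ) - 2) =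
        D / 3 * ((1 + ‖s‖) / (1 + s.re)) / |s.im| ^ 2 := by
      rw [show (2 - ((0 : ℕ) : ℤ)) = ((2 : ℕ) : ℤ) by norm_num,
        show (((0 : ℕ) : ℤ) - 2) = -((2 : ℕ) : ℤ) by norm_num, zpow_neg, zpow_natCast,
        zpow_natCast, mul_pow, mul_pow, h33]
      field_simp
    rw [e, le_div_iff₀ (by positivity), pow_zero, one_mul]
    calc ‖cutSymbol μ s k‖ * |s.im| ^ 2 ≤ ‖cutSymbol μ s k‖ * ‖s‖ ^ 2 := by gcongr
      _ = ‖s‖ * (‖s‖ * ‖cutSymbol μ s k‖) := by ring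
      _ ≤ (1 + ‖s‖) * ((1 + 5 * Cμ) * (A / (1 + s.re))) := by
          gcongr
          linarith
      _ = (1 + 5 * Cμ) * A * ((1 + ‖s‖) / (1 + s.re)) := by ring
      _ ≤ _ := by
          refine mul_le_mul_of_nonneg_right ?_ (by positivity)
          linarith
  · have e : D * lam ^ (2 - ((1 : ℕ) : ℤ)) * ((1 + ‖s‖) / (1 + s.re)) *
        (Real.sqrt 3 * lam * |s.im|) ^ (((1 : ℕ) : ℤ) - 2) =
        D / Real.sqrt 3 * ((1 + ‖s‖) / (1 + s.re)) / |s.im| := by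
      rw [show (2 - ((1 : ℕ) : ℤ)) = 1 by norm_num,
        show (((1 : ℕ) : ℤ) - 2) = -1 by norm_num, zpow_one, zpow_neg_one]
      field_simp
    have h4 : A ≤ D / Real.sqrt 3 := by
      rw [le_div_iff₀ h3]
      have : Real.sqrt 3 ≤ 3 := Real.sqrt_le_self_iff.2 (Or.inr (by norm_num))
      nlinarith
    rw [e, le_div_iff₀ hb, pow_one]
    calc k * ‖cutSymbol μ s k‖ * |s.im| ≤ A / (1 + s.re) * (1 + ‖s‖) := by
          gcongr
          linarith
      _ = A * ((1 + ‖s‖) / (1 + s.re)) := by ring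
      _ ≤ _ := mul_le_mul_of_nonneg_right h4 (by positivity)

theorem gradNorm_freqCut_le (hμ : IsCutoff R Cμ μ) {s : ℂ} {φ : L2}
    (hφ : Integrable (φ : E3 → ℂ)) (hz : MemLp (conv (cutKernel μ s) φ) 2 volume) {S : Set E3}
    (hS : MeasurableSet S) {p : ℕ} {B : ℝ} (hB : 0 ≤ B)
    (h : ∀ ξ ∈ S, 0 < 2 * Real.pi * ‖ξ‖ →
      (2 * Real.pi * ‖ξ‖) ^ p * ‖cutSymbol μ s (2 * Real.pi * ‖ξ‖)‖ ≤ B) :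
    gradNorm p (freqCut S hS hz.toLp) ≤ ENNReal.ofReal (B * ‖φ‖) := by
  rw [← Lp.norm_fourier_eq φ]
  refine gradNorm_le_of_fourier hB ?_
  filter_upwards [fourier_conv_cutKernel hμ s hφ hz, fourier_freqCut hS hz.toLp]
    with ξ ⟨hk, hξ⟩ h2
  rw [h2]
  by_cases hm : ξ ∈ S
  · rw [Set.indicator_of_mem hm, hξ, norm_mul, ← mul_assoc]
    exact mul_le_mul_of_nonneg_right (h ξ hm hk) (norm_nonneg _)
  · rw [Set.indicator_of_notMem hm, norm_zero, mul_zero]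
    positivity

end Splitting

end HelmholtzSplitting

end

/-! ### Assembly of the three claims. -/

theorem mainTheorem5 (R : ℝ) (hR : 0 < R) (μ : ℝ → ℝ) (Cμ : ℝ)
    (hμ : HelmholtzSplitting.IsCutoff R Cμ μ) :
    -- both convolutions are well defined, and they agree on the ball
    (∀ φ : HelmholtzSplitting.L2, HelmholtzSplitting.SupportedInBall R φ →
      ∀ ζ : ℂ, 0 ≤ ζ.re →
        HelmholtzSplitting.ConvConverges
          (HelmholtzSplitting.kernel (starRingEnd ℂ ζ)) φ ∧
        HelmholtzSplitting.ConvConverges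
          (HelmholtzSplitting.cutKernel μ (starRingEnd ℂ ζ)) φ ∧
        ∀ x ∈ Metric.ball (0 : HelmholtzSplitting.E3) R,
          HelmholtzSplitting.conv (HelmholtzSplitting.kernel (starRingEnd ℂ ζ)) φ x =
            HelmholtzSplitting.conv
              (HelmholtzSplitting.cutKernel μ (starRingEnd ℂ ζ)) φ x) ∧
    -- stability of the cut-off solution
    (∃ C : ℝ, 0 < C ∧
      ∀ φ : HelmholtzSplitting.L2, HelmholtzSplitting.SupportedInBall R φ →
      ∀ ζ : ℂ, 0 ≤ ζ.re →
        ∃ hz : MemLp (HelmholtzSplitting.conv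
            (HelmholtzSplitting.cutKernel μ (starRingEnd ℂ ζ)) φ) 2 volume,
          HelmholtzSplitting.weightedNorm ‖ζ‖ hz.toLp ≤
            ENNReal.ofReal (C / (1 + ζ.re) * ‖φ‖)) ∧
    -- frequency splitting
    (∀ lam0 : ℝ, 1 < lam0 → ∃ C' : ℝ, 0 < C' ∧
      ∀ φ : HelmholtzSplitting.L2, HelmholtzSplitting.SupportedInBall R φ →
      ∀ ζ : ℂ, 0 ≤ ζ.re → ζ.im ≠ 0 → ∀ lam : ℝ, lam0 ≤ lam →
        ∃ zH zA : HelmholtzSplitting.L2,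
          (HelmholtzSplitting.conv
              (HelmholtzSplitting.cutKernel μ (starRingEnd ℂ ζ)) φ
            =ᵐ[volume] fun x => zH x + zA x) ∧
          HelmholtzSplitting.IsHighFrequency (lam * |ζ.im|) zH ∧
          HelmholtzSplitting.IsLowFrequency (lam * |ζ.im|) zA ∧
          (∀ p : ℕ, p ≤ 2 →
            HelmholtzSplitting.gradNorm p zH ≤
              ENNReal.ofReal (C' * (lam / (lam - 1)) * (‖ζ‖ / ζ.im) ^ 2 *
                (lam * |ζ.im|) ^ ((p : ℤ) - 2) * ‖φ‖)) ∧
          (∀ p : ℕ, 2 ≤ p →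
            HelmholtzSplitting.gradNorm p zA ≤
              ENNReal.ofReal (C' * ((1 + ‖ζ‖) / (1 + ζ.re)) *
                (Real.sqrt 3 * lam * |ζ.im|) ^ ((p : ℤ) - 2) * ‖φ‖)) ∧
          (∀ p : ℕ, p ≤ 1 →
            HelmholtzSplitting.gradNorm p zA ≤
              ENNReal.ofReal (C' * lam ^ (2 - (p : ℤ)) * ((1 + ‖ζ‖) / (1 + ζ.re)) *
                (Real.sqrt 3 * lam * |ζ.im|) ^ ((p : ℤ) - 2) * ‖φ‖))) := by
  have hC := hμ.const_nonneg hR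
  refine ⟨fun φ hφ ζ _ => ⟨HelmholtzSplitting.convConverges_kernel _ hφ,
    HelmholtzSplitting.convConverges_of_memLp (HelmholtzSplitting.memLp_cutKernel hμ _) φ,
    fun x hx => HelmholtzSplitting.conv_kernel_eq_conv_cutKernel hμ _ hφ hx⟩,
    HelmholtzSplitting.exists_weightedNorm_le hR hμ, fun lam0 hlam0 => ?_⟩
  have hD : 0 < HelmholtzSplitting.splitConst R Cμ := by
    unfold HelmholtzSplitting.splitConst
    positivity
  -- The constant is independent of `lam0`: degeneration as `λ → 1` is carried by the explicit
  -- factor `λ/(λ-1)`.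
  refine ⟨HelmholtzSplitting.splitConst R Cμ, hD, fun φ hφ ζ hζ him lam hlam => ?_⟩
  have hlam1 : 1 < lam := hlam0.trans_le hlam
  have hlam1' : 0 < lam - 1 := sub_pos.2 hlam1
  have hs : 0 ≤ (starRingEnd ℂ ζ).re := by simpa using hζ
  have hsim : (starRingEnd ℂ ζ).im ≠ 0 := by simpa using him
  have hz := HelmholtzSplitting.memLp_conv
    (HelmholtzSplitting.integrable_cutKernel hμ (starRingEnd ℂ ζ))
    (HelmholtzSplitting.memLp_cutKernel hμ _) hφ.integrable
  have hS : MeasurableSet {ξ : HelmholtzSplitting.E3 | lam * |ζ.im| ≤ 2 * Real.pi * ‖ξ‖} :=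
    measurableSet_le (by fun_prop) (by fun_prop)
  have hlow : ∀ ξ ∈ {ξ : HelmholtzSplitting.E3 | lam * |ζ.im| ≤ 2 * Real.pi * ‖ξ‖}ᶜ,
      2 * Real.pi * ‖ξ‖ < lam * |(starRingEnd ℂ ζ).im| := by
    intro ξ hξ
    simpa using hξ
  refine ⟨HelmholtzSplitting.freqCut _ hS hz.toLp, HelmholtzSplitting.freqCut _ hS.compl hz.toLp,
    ?_, ?_, ?_, fun p hp => ?_, fun p hp => ?_, fun p hp => ?_⟩
  · refine hz.coeFn_toLp.symm.trans ?_
    have h := Lp.coeFn_add (HelmholtzSplitting.freqCut _ hS hz.toLp)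
      (HelmholtzSplitting.freqCut _ hS.compl hz.toLp)
    rw [HelmholtzSplitting.freqCut_add_freqCut_compl] at h
    exact h
  · filter_upwards [HelmholtzSplitting.fourier_freqCut hS hz.toLp] with ξ hξ h
    rw [hξ, Set.indicator_of_notMem (by simpa using h)]
  · filter_upwards [HelmholtzSplitting.fourier_freqCut hS.compl hz.toLp] with ξ hξ h
    rw [hξ, Set.indicator_of_notMem (by simpa using h)]
  · refine HelmholtzSplitting.gradNorm_freqCut_le hμ hφ.integrable hz hS (by positivity)
      fun ξ hξ hk => ?_
    have h := HelmholtzSplitting.high_symbol_le hμ hR hs hsim hk hlam1 (by simpa using hξ) hp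
    -- Conjugation flips the sign of the imaginary part; the square removes it.
    simpa [div_pow] using h
  · refine HelmholtzSplitting.gradNorm_freqCut_le hμ hφ.integrable hz hS.compl (by positivity)
      fun ξ hξ hk => ?_
    have h := HelmholtzSplitting.low_symbol_le hμ hR hs hk (hlow ξ hξ).le hp
    simpa using h
  · refine HelmholtzSplitting.gradNorm_freqCut_le hμ hφ.integrable hz hS.compl (by positivity)
      fun ξ hξ hk => ?_
    have h := HelmholtzSplitting.low_symbol_le' hμ hR hs hsim hk (by linarith : 0 < lam) hp
    simpa using h
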